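/- For a finite simple graph $G$ with vertex set $\{1,\dots,N\}$, order the edges $\{a<b\}$ lexicographically. An enhanced state of $G$ is a pair $S=(s,c)$, where $s\subseteq E(G)$ and $c$ assigns to each connected component of the spanning graph $[G:s]=(V(G),s)$ one of the colours $1,x\in\mathbb{Z}[x]/(x^2)$. Let $C^{i,j}(G)$ be the free $\mathbb{Z}$-module on the enhanced states with $\#s=i$ and exactly $j$ components coloured $x$, and let $\partial^{i,j}\colon C^{i,j}(G)\to C^{i+1,j}(G)$ be given by $$\partial^{i,j}(S)=\sum_{e\in E(G)\setminus s}(-1)^{n(e)}S_e ,$$ where $n(e)$ is the number of edges of $s$ smaller than $e$ and $S_e=(s\cup\{e\},c_e)$: if $e$ joins two different components of $[G:s]$, the new component gets the product in $\mathbb{Z}[x]/(x^2)$ of their two colours (and $S_e=0$ if this product is $0$), and all other colours are unchanged. The chromatic homology $H^i(G)$ ($i\ge 0$) is the graded $\mathbb{Z}$-module $\bigoplus_j H^{i,j}(G)$ with $H^{i,j}(G)=\ker\partial^{i,j}/\operatorname{im}\partial^{i-1,j}$, where $C^{-1,j}(G)=0$. For a graded $\mathbb{Z}$-module $M$ let $M\{l\}_j=M_{j-l}$,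 and let $\mathbb{Z}$ be concentrated in degree $0$. Theorem. For $n\ge 4$ the chromatic homology of the complete graph $K_n$ on $n$ vertices is given recursively, up to isomorphism of graded $\mathbb{Z}$-modules, by $$H^i(K_n)\cong\begin{cases}\mathbb{Z}\{n\} & i=0,\\ H^{i-1}(K_{n-1})^{\oplus(n-2)}\oplus H^i(K_{n-1})\{1\} & 1\le i\le n-2,\\ 0 & i\ge n-1.\end{cases}$$ -/

import Mathlib

noncomputable section

namespace ChromaticHomology

/-! ### Graded abelian groups -/

/-- A graded `ℤ`-module `M = ⨁ j, M j`, given by its homogeneous components. -/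
abbrev GrMod : Type 1 := ℤ → ModuleCat.{0} ℤ

namespace GrMod

/-- The shift `M{l}`, with `M{l}_j = M_{j-l}`. -/
def shift (M : GrMod) (l : ℤ) : GrMod := fun j => M (j - l)

/-- The direct sum of two graded modules. -/
def sum (M N : GrMod) : GrMod := fun j => ModuleCat.of ℤ (M j × N j)

/-- The direct sum `M^{⊕ k}` of `k` copies of a graded module. -/
def power (M : GrMod) (k : ℕ) : GrMod := fun j => ModuleCat.of ℤ (Fin k → M j)

/-- The graded module `ℤ`, concentrated in degree `0`. -/
def int : GrMod := fun j =>
  ModuleCat.of ℤ ((if j = 0 then ⊤ else ⊥ : Submodule ℤ ℤ) : Submodule ℤ ℤ)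

/-- The zero graded module. -/
def zero : GrMod := fun _ => ModuleCat.of ℤ PUnit.{1}

/-- Two graded modules are isomorphic: there is a degree-preserving linear isomorphism. -/
def Isomorphic (M N : GrMod) : Prop := Nonempty (∀ j : ℤ, M j ≃ₗ[ℤ] N j)

end GrMod

/-! ### Enhanced states -/

variable {V : Type} [LinearOrder V]

/-- The lexicographic order on edges: `{i₁, i₂} < {j₁, j₂}` (with `i₁ ≤ i₂`, `j₁ ≤ j₂`) when
`(i₁, i₂) < (j₁, j₂)` lexicographically. -/
def EdgeLT (e f : Sym2 V) : Prop := toLex (e.inf, e.sup) < toLex (f.inf, f.sup)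

/-- The spanning graph `[G : s] = (V(G), s)`. -/
abbrev spanning (s : Finset (Sym2 V)) : SimpleGraph V :=
  SimpleGraph.fromEdgeSet (s : Set (Sym2 V))

/-- An enhanced state `S = (s, c)` of `G`: a set `s` of edges of `G` and a colouring `c` of the
connected components of `[G : s]` by `1` and `x`. The colouring is recorded by the set `xs` of the
components coloured `x`; all other components are coloured `1`. -/
@[ext]
structure EnhancedState (G : SimpleGraph V) where
  /-- the edges of the state -/
  s : Finset (Sym2 V)
  /-- they are edges of `G` -/
  s_subset : (s : Set (Sym2 V)) ⊆ G.edgeSet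
  /-- the components coloured `x` -/
  xs : Finset (spanning s).ConnectedComponent

namespace EnhancedState

variable {G : SimpleGraph V}

/-- Enhanced states `S` with `i(S) = #s = i` and `j(S) = #{components coloured x} = j`. -/
abbrev OfBidegree (G : SimpleGraph V) (i : ℕ) (j : ℤ) : Type :=
  {S : EnhancedState G // S.s.card = i ∧ (S.xs.card : ℤ) = j}

theorem spanning_le_insert (s : Finset (Sym2 V)) (e : Sym2 V) :
    spanning s ≤ spanning (insert e s) :=
  SimpleGraph.fromEdgeSet_mono (by simp)

/-- The map sending a component of `[G : s]` to the component of `[G : s ∪ {e}]` containing it. -/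
def compMap (s : Finset (Sym2 V)) (e : Sym2 V) :
    (spanning s).ConnectedComponent → (spanning (insert e s)).ConnectedComponent :=
  SimpleGraph.ConnectedComponent.map (SimpleGraph.Hom.ofLE (spanning_le_insert s e))

/-- The number `n(e)` of edges of `s` that are ordered before `e`. -/
def numBefore (s : Finset (Sym2 V)) (e : Sym2 V) : ℕ :=
  {f : Sym2 V | f ∈ s ∧ EdgeLT f e}.ncard

/-- `S_e` is nonzero. The colour `c_e(D)` of a component `D` of `[G : s ∪ {e}]` is the product in
`ℤ[x]/(x²)` of the colours of the components of `[G : s]` contained in `D` (two components if `e`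
joins them to form `D`, one component otherwise). It is `1`, `x` or `0` when
none, one or two of these are coloured `x`; so `S_e ≠ 0` iff distinct `x`-coloured components stay
distinct. -/
def Survives (S : EnhancedState G) (e : Sym2 V) : Prop :=
  Set.InjOn (compMap S.s e) (S.xs : Set (spanning S.s).ConnectedComponent)

open Classical in
/-- The enhanced state `S_e = (s ∪ {e}, c_e)` (meaningful when `S.Survives e`): a component is
coloured `x` when it contains an `x`-coloured component of `[G : s]`. -/
def addEdge (S : EnhancedState G) (e : Sym2 V) (he : e ∈ G.edgeSet) : EnhancedState G where
  s := insert e S.s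
  s_subset := by
    rw [Finset.coe_insert]
    exact Set.insert_subset he S.s_subset
  xs := S.xs.image (compMap S.s e)

/-- Adding an edge raises `i` by one and keeps `j`. -/
theorem addEdge_bidegree {i : ℕ} {j : ℤ} (S : OfBidegree G i j) (e : Sym2 V)
    (he : e ∈ G.edgeSet) (hs : e ∉ S.1.s) (hS : S.1.Survives e) :
    (S.1.addEdge e he).s.card = i + 1 ∧ ((S.1.addEdge e he).xs.card : ℤ) = j := by
  refine ⟨?_, ?_⟩
  · show (insert e S.1.s).card = i + 1
    rw [Finset.card_insert_of_notMem hs, S.2.1]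
  · classical
    refine Eq.trans (congrArg _ ?_) S.2.2
    exact Finset.card_image_of_injOn hS

end EnhancedState

open EnhancedState

variable [Fintype V]

/-! ### The chromatic complex and its homology -/

/-- `C^{i,j}(G)`: the free `ℤ`-module on the enhanced states `S` with `i(S) = i`, `j(S) = j`. -/
abbrev Chain (G : SimpleGraph V) (i : ℕ) (j : ℤ) : Type := OfBidegree G i j →₀ ℤ

open Classical in
/-- The differential on a generator: `∂ S = ∑_{e ∈ E(G) ∖ s} (-1)^{n(e)} S_e`. -/
def diffState {G : SimpleGraph V} {i : ℕ} {j : ℤ} (S : OfBidegree G i j) : Chain G (i + 1) j :=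
  ∑ e : Sym2 V,
    if h : e ∈ G.edgeSet ∧ e ∉ S.1.s ∧ S.1.Survives e then
      Finsupp.single ⟨S.1.addEdge e h.1, addEdge_bidegree S e h.1 h.2.1 h.2.2⟩
        ((-1 : ℤ) ^ numBefore S.1.s e)
    else 0

/-- The differential `∂^{i,j} : C^{i,j}(G) → C^{i+1,j}(G)`. -/
def diff (G : SimpleGraph V) (i : ℕ) (j : ℤ) : Chain G i j →ₗ[ℤ] Chain G (i + 1) j :=
  Finsupp.linearCombination ℤ diffState

/-- The coboundaries in `C^{i,j}(G)`, i.e. the image of `∂^{i-1,j}`, where `C^{-1,j}(G) = 0`. -/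
def boundaries (G : SimpleGraph V) : (i : ℕ) → (j : ℤ) → Submodule ℤ (Chain G i j)
  | 0, _ => ⊥
  | i + 1, j => LinearMap.range (diff G i j)

/-- The chromatic homology `H^i(G)`, a graded `ℤ`-module whose component of degree `j` is
`H^{i,j}(G) = ker ∂^{i,j} / im ∂^{i-1,j}` (`submoduleOf` views the image as a submodule of the
kernel). -/
def H (G : SimpleGraph V) (i : ℕ) : GrMod := fun j =>
  ModuleCat.of ℤ
    (LinearMap.ker (diff G i j) ⧸ (boundaries G i j).submoduleOf (LinearMap.ker (diff G i j)))

/-- The complete graph `K_n` on `n` vertices. -/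
abbrev K (n : ℕ) : SimpleGraph (Fin n) := ⊤

end ChromaticHomology

end

/-! The components of `[G : s]` coloured by `1` and `x` form a basis of the quotient of the
polynomial ring on the vertices by the squares `X v ^ 2` and the differences `X a - X b` for edges
of `s`. Chromatic homology can therefore be computed with families of honest polynomials indexed by
edge sets, where `preDiff` squares to zero on the nose and the graph enters only through the
submodule `nullChains` of families that represent zero (`homologyEquivModel`). Elements can then be
manipulated by identities between polynomials, with membership in ideals checked at the end.

Remove the vertex `0` from the complete graph on `r + 2` vertices and sort edge sets by their star,
the set of edges at `0`. When the star contains the edges from `0` to `k` and `l`, adding or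
removing the chord between `k` and `l` does not change the components. Contracting along such a
chord shows that the part with at least two star edges is acyclic (`exists_preDiff_of_star`). With
no star edge, the vertex `0` is isolated and a chain has the form `a₀ + X 0 * a₁`; with the single
star edge to `k`, the vertex `0` merges with `k`, giving one shifted copy of the smaller complex for
each of the `r + 1` neighbours. The differential sends `a₀ + X 0 * a₁` to `a₀ + X k * a₁` in the
copy of `k`. So `a₀` cancels against the diagonal of these copies (`exists_preDiff_of_parts`). What
survives is `a₁` (`linearPart`) and the `r` differences of star parts (`starDiff`), with connecting
map the multiplications by `X k.succ - X 0` (`starDiff_preDiff`).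

These connecting maps are null-homotopic as soon as a third vertex exists. Contraction along an edge
`{a, b}` fails to respect the relations only by multiples of `X a - X b`, and the factor `X a + X b`
repairs this because the product is a difference of squares. Hence multiplication by `X a + X b` is
null-homotopic, and so is `X a - X b`, the difference of `X a + X l` and `X l + X b`. Correcting
`starDiff` by this homotopy splits the homology into the two summands of the recursion
(`nonempty_modelHomology_equiv`).

Vanishing in high degrees uses the same reduction without the splitting, so its induction can start
at one vertex. In degree zero no boundaries occur, and three vertices force every squarefree
coefficient of a cycle except that of the product of all variables to vanish. -/

noncomputable section

namespace ChromaticHomology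

open MvPolynomial EnhancedState

set_option linter.unusedSectionVars false

/-! ### Subquotients -/

section Subquotient

variable {M P : Type*} [AddCommGroup M] [AddCommGroup P]

/-- A subquotient `Z / B` is isomorphic to `P` as soon as there is a surjection `Z → P` with
kernel `Z ∩ B`. -/
def subquotientEquiv (Z B : Submodule ℤ M) (L : Z →ₗ[ℤ] P) (hL : Function.Surjective L)
    (hB : ∀ z : Z, L z = 0 ↔ (z : M) ∈ B) : (Z ⧸ B.submoduleOf Z) ≃ₗ[ℤ] P :=
  (Submodule.quotEquivOfEq _ _ (by ext z; exact (hB z).symm)).trans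
    (L.quotKerEquivOfSurjective hL)

/-- A linear map inducing a bijection between subquotients. -/
def subquotientCongr {M' : Type*} [AddCommGroup M'] (Z B : Submodule ℤ M) (Z' B' : Submodule ℤ M')
    (φ : M →ₗ[ℤ] M') (hZ : ∀ z ∈ Z, φ z ∈ Z') (hB : ∀ z ∈ Z, φ z ∈ B' ↔ z ∈ B)
    (hsurj : ∀ z' ∈ Z', ∃ z ∈ Z, φ z - z' ∈ B') :
    (Z ⧸ B.submoduleOf Z) ≃ₗ[ℤ] (Z' ⧸ B'.submoduleOf Z') :=
  subquotientEquiv Z B ((B'.submoduleOf Z').mkQ ∘ₗ φ.restrict hZ)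
    (by
      intro q
      obtain ⟨z', rfl⟩ := Submodule.mkQ_surjective _ q
      obtain ⟨z, hz, h⟩ := hsurj z' z'.2
      exact ⟨⟨z, hz⟩, (Submodule.Quotient.eq _).2 h⟩)
    (by
      intro z
      rw [← hB z z.2]
      exact Submodule.Quotient.mk_eq_zero _)

end Subquotient

/-! ### Signs -/

section Signs

variable {V : Type} [LinearOrder V]

theorem edgeLT_or_edgeLT {e f : Sym2 V} (h : e ≠ f) :
    EdgeLT e f ∧ ¬ EdgeLT f e ∨ EdgeLT f e ∧ ¬ EdgeLT e f := by
  unfold EdgeLT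
  rcases lt_trichotomy (toLex (e.inf, e.sup)) (toLex (f.inf, f.sup)) with h' | h' | h'
  · exact Or.inl ⟨h', h'.asymm⟩
  · have h2 : (e.inf, e.sup) = (f.inf, f.sup) := h'
    rw [Prod.mk.injEq] at h2
    exact absurd (Sym2.inf_eq_inf_and_sup_eq_sup.1 h2) h
  · exact Or.inr ⟨h', h'.asymm⟩

open Classical in
theorem numBefore_insert {s : Finset (Sym2 V)} {e : Sym2 V} (he : e ∉ s) (f : Sym2 V) :
    numBefore (insert e s) f = numBefore s f + if EdgeLT e f then 1 else 0 := by
  have hfin : {g : Sym2 V | g ∈ s ∧ EdgeLT g f}.Finite :=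
    s.finite_toSet.subset fun g hg => hg.1
  unfold numBefore
  split_ifs with h
  · rw [← Set.ncard_insert_of_notMem (fun hg => he hg.1) hfin]
    congr 1
    ext g
    simp only [Finset.mem_insert, Set.mem_ofPred_eq, Set.mem_insert_iff]
    constructor
    · rintro ⟨rfl | hg, hgf⟩
      exacts [Or.inl rfl, Or.inr ⟨hg, hgf⟩]
    · rintro (rfl | ⟨hg, hgf⟩)
      exacts [⟨Or.inl rfl, h⟩, ⟨Or.inr hg, hgf⟩]
  · rw [add_zero]
    congr 1
    ext g
    simp only [Finset.mem_insert, Set.mem_ofPred_eq]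
    constructor
    · rintro ⟨rfl | hg, hgf⟩
      exacts [absurd hgf h, ⟨hg, hgf⟩]
    · rintro ⟨hg, hgf⟩
      exact ⟨Or.inr hg, hgf⟩

/-- The sign `(-1)^{n(e)}` with which `e` is added to `s`. -/
def edgeSign (s : Finset (Sym2 V)) (e : Sym2 V) : ℤ := (-1) ^ numBefore s e

theorem edgeSign_mul_self (s : Finset (Sym2 V)) (e : Sym2 V) :
    edgeSign s e * edgeSign s e = 1 := by
  rw [edgeSign, ← mul_pow]
  simp

/-- Exactly one of `e`, `f` precedes the other, so exactly one of the two signs flips when the other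
edge is present. -/
theorem edgeSign_swap {s : Finset (Sym2 V)} {e f : Sym2 V} (he : e ∉ s) (hf : f ∉ s)
    (hef : e ≠ f) :
    edgeSign s e * edgeSign (insert e s) f = -(edgeSign s f * edgeSign (insert f s) e) := by
  unfold edgeSign
  rw [numBefore_insert he, numBefore_insert hf]
  rcases edgeLT_or_edgeLT hef with ⟨h1, h2⟩ | ⟨h1, h2⟩ <;> simp only [h1, h2, if_true, if_false] <;>
    ring

end Signs

/-! ### Homogeneous polynomials -/

section Homogeneous

/-- Polynomials that are homogeneous of degree `j`, where `j` is an integer. -/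
def homogeneousPart (V : Type) (j : ℤ) : Submodule ℤ (MvPolynomial V ℤ) where
  carrier := {p | ∀ m, coeff m p ≠ 0 → (m.degree : ℤ) = j}
  zero_mem' := fun m h => absurd (coeff_zero m) h
  add_mem' := by
    intro p q hp hq m h
    rw [coeff_add] at h
    by_cases h' : coeff m p = 0
    · exact hq m (by simpa [h'] using h)
    · exact hp m h'
  smul_mem' := by
    intro a p hp m h
    rw [coeff_smul] at h
    exact hp m (right_ne_zero_of_mul h)

variable {V W : Type} {j : ℤ}

theorem X_mul_mem_homogeneousPart {p : MvPolynomial V ℤ} (hp : p ∈ homogeneousPart V j) (v : V) :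
    X v * p ∈ homogeneousPart V (j + 1) := by
  classical
  intro m h
  rw [coeff_X_mul'] at h
  split_ifs at h with hv
  · rw [← hp _ h]
    have hle : Finsupp.single v 1 ≤ m := by
      rw [Finsupp.single_le_iff]
      exact Nat.one_le_iff_ne_zero.2 (Finsupp.mem_support_iff.1 hv)
    conv_lhs => rw [← tsub_add_cancel_of_le hle]
    simp [Finsupp.degree_single]
  · exact absurd rfl h

theorem rename_mem_homogeneousPart {p : MvPolynomial V ℤ} (hp : p ∈ homogeneousPart V j)
    (g : V → W) : rename g p ∈ homogeneousPart W j := by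
  intro m h
  obtain ⟨u, rfl, hu⟩ := coeff_rename_ne_zero g p m h
  rw [Finsupp.degree_mapDomain]
  exact hp u hu

theorem finSuccEquiv_coeff_mem_homogeneousPart {n : ℕ} {p : MvPolynomial (Fin (n + 1)) ℤ}
    (hp : p ∈ homogeneousPart (Fin (n + 1)) j) (k : ℕ) :
    (finSuccEquiv ℤ n p).coeff k ∈ homogeneousPart (Fin n) (j - k) := by
  intro m h
  rw [finSuccEquiv_coeff_coeff] at h
  rw [← hp _ h, Finsupp.degree_eq_sum, Finsupp.degree_eq_sum, Fin.sum_univ_succ]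
  simp

end Homogeneous

/-! ### The polynomial model of the chromatic complex -/

section Model

variable {V : Type} [LinearOrder V]

/-- Families of polynomials indexed by edge sets. -/
abbrev PreChain (V : Type) : Type := Finset (Sym2 V) → MvPolynomial V ℤ

/-- The differential on families of polynomials. -/
def preDiff : PreChain V →ₗ[ℤ] PreChain V where
  toFun f s := ∑ e ∈ s, edgeSign (s.erase e) e • f (s.erase e)
  map_add' f g := by
    funext s
    simp [Finset.sum_add_distrib]
  map_smul' a f := by
    funext s
    simp only [Pi.smul_apply, RingHom.id_apply, Finset.smul_sum]
    exact Finset.sum_congr rfl fun e _ => smul_comm _ _ _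

theorem preDiff_apply (f : PreChain V) (s : Finset (Sym2 V)) :
    preDiff f s = ∑ e ∈ s, edgeSign (s.erase e) e • f (s.erase e) := rfl

theorem preDiff_insert (f : PreChain V) {s : Finset (Sym2 V)} {e : Sym2 V} (he : e ∉ s) :
    preDiff f (insert e s) = edgeSign s e • f s +
      ∑ e' ∈ s, edgeSign (insert e (s.erase e')) e' • f (insert e (s.erase e')) := by
  rw [preDiff_apply, Finset.sum_insert he, Finset.erase_insert he]
  congr 1
  refine Finset.sum_congr rfl fun e' he' => ?_
  have : e ≠ e' := fun h => he (h ▸ he')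
  rw [Finset.erase_insert_of_ne this]

/-- Removing two edges in the two possible orders gives opposite signs, so the double sum equals its
own negative; polynomials over `ℤ` have no 2-torsion. -/
theorem preDiff_preDiff (f : PreChain V) : preDiff (preDiff f) = 0 := by
  funext s
  have key : preDiff (preDiff f) s = -preDiff (preDiff f) s := by
    conv_lhs => simp only [preDiff_apply, Finset.smul_sum, smul_smul]
    conv_rhs => simp only [preDiff_apply, Finset.smul_sum, smul_smul, ← Finset.sum_neg_distrib]
    rw [Finset.sum_comm' (s' := fun e => s.erase e) (t' := s)]
    · refine Finset.sum_congr rfl fun e he => Finset.sum_congr rfl fun e' he' => ?_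
      have hne : e' ≠ e := (Finset.mem_erase.1 he').1
      have he's : e' ∈ s := (Finset.mem_erase.1 he').2
      rw [Finset.erase_right_comm (a := e'), ← neg_smul]
      congr 1
      have h1 : s.erase e' = insert e ((s.erase e).erase e') := by
        rw [Finset.erase_right_comm, Finset.insert_erase (Finset.mem_erase.2 ⟨hne.symm, he⟩)]
      have h2 : s.erase e = insert e' ((s.erase e).erase e') := (Finset.insert_erase he').symm
      have h3 := edgeSign_swap (s := (s.erase e).erase e') (e := e) (f := e') (by simp) (by simp)
        hne.symm
      rw [← h1, ← h2] at h3
      linarith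
    · intro e e'
      simp only [Finset.mem_erase]
      tauto
  have h2 : (2 : ℤ) • preDiff (preDiff f) s = 0 := by
    rw [two_smul]
    nth_rewrite 1 [key]
    exact neg_add_cancel _
  simpa using h2

/-- The contraction of families of polynomials along the edge `e`. -/
def contraction (e : Sym2 V) : PreChain V →ₗ[ℤ] PreChain V where
  toFun f s := if e ∈ s then 0 else edgeSign s e • f (insert e s)
  map_add' f g := by
    funext s
    by_cases h : e ∈ s <;> simp [h]
  map_smul' a f := by
    funext s
    by_cases h : e ∈ s
    · simp [h]
    · simpa [h] using mul_left_comm _ _ _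

theorem contraction_of_mem {e : Sym2 V} {s : Finset (Sym2 V)} (h : e ∈ s) (f : PreChain V) :
    contraction e f s = 0 := if_pos h

theorem contraction_of_notMem {e : Sym2 V} {s : Finset (Sym2 V)} (h : e ∉ s) (f : PreChain V) :
    contraction e f s = edgeSign s e • f (insert e s) := if_neg h

/-- Before relations are imposed the complex is contractible along any edge. The homotopy need not
preserve `nullChains`, since the ideal of `insert e s` can exceed that of `s`; the later arguments
work where this defect is absent or can be repaired. -/
theorem preDiff_contraction_add (e : Sym2 V) (f : PreChain V) :
    preDiff (contraction e f) + contraction e (preDiff f) = f := by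
  funext s
  rw [Pi.add_apply]
  by_cases he : e ∈ s
  · rw [contraction_of_mem he, add_zero, preDiff_apply, Finset.sum_eq_single_of_mem e he]
    · rw [contraction_of_notMem (by simp), Finset.insert_erase he, smul_smul, edgeSign_mul_self,
        one_smul]
    · intro e' _ hne
      rw [contraction_of_mem (Finset.mem_erase.2 ⟨hne.symm, he⟩), smul_zero]
  · rw [contraction_of_notMem he, preDiff_insert f he, smul_add, smul_smul, edgeSign_mul_self,
      one_smul, add_comm, add_assoc, preDiff_apply, Finset.smul_sum, ← Finset.sum_add_distrib,
      Finset.sum_eq_zero, add_zero]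
    intro e' he'
    have hne : e' ≠ e := fun h => he (h ▸ he')
    have h1 : e ∉ s.erase e' := fun h => he (Finset.mem_of_mem_erase h)
    rw [contraction_of_notMem h1, smul_smul, smul_smul, ← add_smul]
    have h3 := edgeSign_swap (s := s.erase e') (e := e') (f := e) (by simp) h1 hne
    rw [Finset.insert_erase he'] at h3
    have h4 := edgeSign_mul_self s e
    have h5 := edgeSign_mul_self (s.erase e') e
    -- This is `edgeSign_swap` with signs moved across the equation, which is possible because each
    -- sign squares to one.
    have : edgeSign s e * edgeSign (insert e (s.erase e')) e' +
        edgeSign (s.erase e') e' * edgeSign (s.erase e') e = 0 := by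
      linear_combination edgeSign s e * edgeSign (s.erase e') e * h3 -
        edgeSign (s.erase e') e' * edgeSign (s.erase e') e * h4 -
        edgeSign s e * edgeSign (insert e (s.erase e')) e' * h5
    rw [this, zero_smul]

/-- The ideal of relations of `⨂ ℤ[x]/(x²)` over the components of `[G : s]`, as a quotient of the
polynomial ring on the vertices. -/
def relIdeal (s : Finset (Sym2 V)) : Ideal (MvPolynomial V ℤ) :=
  Ideal.span ({p | ∃ v, p = X v ^ 2} ∪ {p | ∃ a b, s(a, b) ∈ s ∧ p = X a - X b})

theorem X_sq_mem_relIdeal (s : Finset (Sym2 V)) (v : V) :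
    (X v ^ 2 : MvPolynomial V ℤ) ∈ relIdeal s :=
  Ideal.subset_span (Or.inl ⟨v, rfl⟩)

theorem X_sub_X_mem_relIdeal {s : Finset (Sym2 V)} {a b : V} (h : s(a, b) ∈ s) :
    (X a - X b : MvPolynomial V ℤ) ∈ relIdeal s :=
  Ideal.subset_span (Or.inr ⟨a, b, h, rfl⟩)

theorem relIdeal_le {s : Finset (Sym2 V)} {I : Ideal (MvPolynomial V ℤ)}
    (h1 : ∀ v, (X v ^ 2 : MvPolynomial V ℤ) ∈ I)
    (h2 : ∀ a b, s(a, b) ∈ s → (X a - X b : MvPolynomial V ℤ) ∈ I) : relIdeal s ≤ I := by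
  refine Ideal.span_le.2 ?_
  rintro p (⟨v, rfl⟩ | ⟨a, b, hab, rfl⟩)
  exacts [h1 v, h2 a b hab]

theorem relIdeal_mono {s t : Finset (Sym2 V)} (h : s ⊆ t) : relIdeal s ≤ relIdeal t :=
  relIdeal_le (X_sq_mem_relIdeal t) fun _ _ hab => X_sub_X_mem_relIdeal (h hab)

theorem zsmul_mem_relIdeal {s : Finset (Sym2 V)} {p : MvPolynomial V ℤ} (a : ℤ)
    (h : p ∈ relIdeal s) : a • p ∈ relIdeal s :=
  (relIdeal s).toAddSubgroup.zsmul_mem h a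

/-- Both orientations of the new edge must be checked. This is what makes contraction along a chord
compatible with the relations. -/
theorem relIdeal_insert_of_mem {s : Finset (Sym2 V)} {a b : V}
    (h : (X a - X b : MvPolynomial V ℤ) ∈ relIdeal s) :
    relIdeal (insert s(a, b) s) = relIdeal s := by
  refine le_antisymm (relIdeal_le (X_sq_mem_relIdeal s) fun c e hce => ?_)
    (relIdeal_mono (Finset.subset_insert _ _))
  rcases Finset.mem_insert.1 hce with hce | hce
  · rcases Sym2.eq_iff.1 hce with ⟨rfl, rfl⟩ | ⟨rfl, rfl⟩
    · exact h
    · simpa using (relIdeal s).neg_mem h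
  · exact X_sub_X_mem_relIdeal hce

/-- The only new relation is `X a - X b`, and its product with `X a + X b` is `X a ^ 2 - X b ^ 2`.
-/
theorem X_add_X_mul_mem_relIdeal {s : Finset (Sym2 V)} {a b : V} {p : MvPolynomial V ℤ}
    (h : p ∈ relIdeal (insert s(a, b) s)) : (X a + X b) * p ∈ relIdeal s := by
  have hsub : (X a + X b) * (X a - X b : MvPolynomial V ℤ) ∈ relIdeal s := by
    have := (relIdeal s).sub_mem (X_sq_mem_relIdeal s a) (X_sq_mem_relIdeal s b)
    rwa [sq_sub_sq] at this
  refine relIdeal_le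
    (I := Submodule.comap (LinearMap.mulLeft (MvPolynomial V ℤ) (X a + X b)) (relIdeal s))
    (fun v => ?_) (fun c e hce => ?_) h
  · exact (relIdeal s).mul_mem_left _ (X_sq_mem_relIdeal s v)
  · show (X a + X b) * (X c - X e : MvPolynomial V ℤ) ∈ relIdeal s
    rcases Finset.mem_insert.1 hce with hce | hce
    · rcases Sym2.eq_iff.1 hce with ⟨rfl, rfl⟩ | ⟨rfl, rfl⟩
      · exact hsub
      · have := (relIdeal s).neg_mem hsub
        rwa [← mul_neg, neg_sub] at this
    · exact (relIdeal s).mul_mem_left _ (X_sub_X_mem_relIdeal hce)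

/-- The families of polynomials that represent zero in the chromatic complex of `G`. -/
def nullChains (G : SimpleGraph V) : Submodule ℤ (PreChain V) where
  carrier := {f | ∀ s : Finset (Sym2 V), (s : Set (Sym2 V)) ⊆ G.edgeSet → f s ∈ relIdeal s}
  zero_mem' := fun s _ => (relIdeal s).zero_mem
  add_mem' := fun hf hg s hs => (relIdeal s).add_mem (hf s hs) (hg s hs)
  smul_mem' := fun a _ hf s hs => zsmul_mem_relIdeal a (hf s hs)

variable {G : SimpleGraph V}

theorem preDiff_mem_nullChains {f : PreChain V} (hf : f ∈ nullChains G) :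
    preDiff f ∈ nullChains G := by
  intro s hs
  refine (relIdeal s).sum_mem fun e _ => zsmul_mem_relIdeal _ ?_
  have hsub : s.erase e ⊆ s := Finset.erase_subset _ _
  exact relIdeal_mono hsub (hf _ ((Finset.coe_subset.2 hsub).trans hs))

/-- The families of polynomials of bidegree `(i, j)`. -/
def bidegreePart (V : Type) (i j : ℤ) : Submodule ℤ (PreChain V) where
  carrier := {f | ∀ s : Finset (Sym2 V), (f s ≠ 0 → (s.card : ℤ) = i) ∧ f s ∈ homogeneousPart V j}
  zero_mem' := fun s => ⟨fun h => absurd rfl h, (homogeneousPart V j).zero_mem⟩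
  add_mem' := by
    intro f g hf hg s
    refine ⟨fun h => ?_, (homogeneousPart V j).add_mem (hf s).2 (hg s).2⟩
    by_cases h' : f s = 0
    · exact (hg s).1 (by simpa [h'] using h)
    · exact (hf s).1 h'
  smul_mem' := fun a f hf s =>
    ⟨fun h => (hf s).1 fun h0 => h (by rw [Pi.smul_apply, h0, smul_zero]),
      (homogeneousPart V j).smul_mem a (hf s).2⟩

variable {i j : ℤ}

theorem preDiff_mem_bidegreePart {f : PreChain V} (hf : f ∈ bidegreePart V i j) :
    preDiff f ∈ bidegreePart V (i + 1) j := by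
  intro s
  refine ⟨fun h => ?_, Submodule.sum_mem _ fun e _ => Submodule.smul_mem _ _ (hf _).2⟩
  obtain ⟨e, he, hne⟩ := Finset.exists_ne_zero_of_sum_ne_zero h
  rw [← (hf _).1 (right_ne_zero_of_smul hne), ← Finset.card_erase_add_one he]
  push_cast
  rfl

theorem contraction_mem_bidegreePart {f : PreChain V} (hf : f ∈ bidegreePart V i j) (e : Sym2 V) :
    contraction e f ∈ bidegreePart V (i - 1) j := by
  intro s
  by_cases he : e ∈ s
  · rw [contraction_of_mem he]
    exact ⟨fun h => absurd rfl h, Submodule.zero_mem _⟩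
  · rw [contraction_of_notMem he]
    refine ⟨fun h => ?_, Submodule.smul_mem _ _ (hf _).2⟩
    rw [← (hf _).1 (right_ne_zero_of_smul h), Finset.card_insert_of_notMem he]
    push_cast
    ring

theorem eq_zero_of_mem_bidegreePart_of_neg {f : PreChain V} (hf : f ∈ bidegreePart V i j)
    (hi : i < 0) : f = 0 := by
  funext s
  by_contra h
  have := (hf s).1 h
  omega

/-- The cycles of bidegree `(i, j)` of the polynomial model. -/
def modelCycles (G : SimpleGraph V) (i j : ℤ) : Submodule ℤ (PreChain V) :=
  bidegreePart V i j ⊓ (nullChains G).comap preDiff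

/-- The representatives of boundaries of bidegree `(i, j)` of the polynomial model. -/
def modelBoundaries (G : SimpleGraph V) (i j : ℤ) : Submodule ℤ (PreChain V) :=
  (bidegreePart V (i - 1) j).map preDiff ⊔ nullChains G

/-- The homology of the polynomial model. -/
abbrev ModelHomology (G : SimpleGraph V) (i j : ℤ) : Type :=
  modelCycles G i j ⧸ (modelBoundaries G i j).submoduleOf (modelCycles G i j)

theorem mem_modelCycles {f : PreChain V} :
    f ∈ modelCycles G i j ↔ f ∈ bidegreePart V i j ∧ preDiff f ∈ nullChains G := Iff.rfl

theorem mem_modelBoundaries {f : PreChain V} :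
    f ∈ modelBoundaries G i j ↔ ∃ y ∈ bidegreePart V (i - 1) j, f - preDiff y ∈ nullChains G := by
  simp only [modelBoundaries, Submodule.mem_sup, Submodule.mem_map]
  constructor
  · rintro ⟨_, ⟨y, hy, rfl⟩, z, hz, rfl⟩
    exact ⟨y, hy, by simpa using hz⟩
  · rintro ⟨y, hy, h⟩
    exact ⟨_, ⟨y, hy, rfl⟩, _, h, by simp⟩

end Model

/-! ### Squarefree monomials -/

section Squarefree

variable {σ : Type}

/-- The exponent of the squarefree monomial with the given support. -/
def sqfreeExp (Y : Finset σ) : σ →₀ ℕ := ∑ v ∈ Y, Finsupp.single v 1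

theorem sqfreeExp_apply [DecidableEq σ] (Y : Finset σ) (v : σ) :
    sqfreeExp Y v = if v ∈ Y then 1 else 0 := by
  simp [sqfreeExp, Finsupp.finsetSum_apply, Finsupp.single_apply]

theorem sqfreeExp_injective : Function.Injective (sqfreeExp (σ := σ)) := by
  classical
  intro Y Z h
  ext v
  have := DFunLike.congr_fun h v
  rw [sqfreeExp_apply, sqfreeExp_apply] at this
  by_cases h1 : v ∈ Y <;> by_cases h2 : v ∈ Z <;> simp_all

theorem degree_sqfreeExp (Y : Finset σ) : (sqfreeExp Y).degree = Y.card := by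
  simp [sqfreeExp, map_sum]

theorem monomial_sqfreeExp (Y : Finset σ) :
    (monomial (sqfreeExp Y) 1 : MvPolynomial σ ℤ) = ∏ v ∈ Y, X v := by
  rw [sqfreeExp, monomial_sum_one]
  rfl

theorem coeff_sqfreeExp_mul_X_sq (Y : Finset σ) (q : MvPolynomial σ ℤ) (v : σ) :
    coeff (sqfreeExp Y) (q * X v ^ 2) = 0 := by
  classical
  rw [X_pow_eq_monomial, coeff_mul_monomial', if_neg]
  rw [Finsupp.single_le_iff, sqfreeExp_apply]
  split_ifs <;> omega

end Squarefree

/-! ### Comparison of the chromatic complex with the polynomial model -/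

section Comparison

variable {V : Type} [LinearOrder V]

/-- A linear functional that kills all multiples of the defining relations kills the ideal. -/
theorem map_eq_zero_of_mem_relIdeal {s : Finset (Sym2 V)} (L : MvPolynomial V ℤ →ₗ[ℤ] ℤ)
    (h1 : ∀ q v, L (q * X v ^ 2) = 0)
    (h2 : ∀ q a b, s(a, b) ∈ s → L (q * (X a - X b)) = 0) {p : MvPolynomial V ℤ}
    (hp : p ∈ relIdeal s) : L p = 0 := by
  -- `L` is only `ℤ`-linear, so induction over the span needs the statement for all polynomial
  -- multiples.
  suffices h : ∀ q, L (q * p) = 0 by simpa using h 1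
  refine Submodule.span_induction ?_ ?_ ?_ ?_ hp
  · rintro p (⟨v, rfl⟩ | ⟨a, b, hab, rfl⟩) q
    exacts [h1 q v, h2 q a b hab]
  · simp
  · intro x y _ _ hx hy q
    rw [mul_add, map_add, hx, hy, add_zero]
  · intro a x _ hx q
    rw [smul_eq_mul, ← mul_assoc]
    exact hx _

theorem X_sub_X_mem_relIdeal_of_reachable {s : Finset (Sym2 V)} {a b : V}
    (h : (spanning s).Reachable a b) : (X a - X b : MvPolynomial V ℤ) ∈ relIdeal s := by
  obtain ⟨w⟩ := h
  induction w with
  | nil => simp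
  | cons hadj _ ih =>
    have h1 := X_sub_X_mem_relIdeal (V := V) ((SimpleGraph.fromEdgeSet_adj _).1 hadj).1
    simpa using (relIdeal s).add_mem h1 ih

/-- A vertex in a given component. -/
def compRep {s : Finset (Sym2 V)} (c : (spanning s).ConnectedComponent) : V := Quot.out c

theorem mk_compRep {s : Finset (Sym2 V)} (c : (spanning s).ConnectedComponent) :
    (spanning s).connectedComponentMk (compRep c) = c := Quot.out_eq c

/-- The product of the variables attached to a set of components. -/
def compMonomial {s : Finset (Sym2 V)} (Y : Finset (spanning s).ConnectedComponent) :
    MvPolynomial V ℤ := ∏ c ∈ Y, X (compRep c)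

theorem compMonomial_mem_homogeneousPart {s : Finset (Sym2 V)}
    (Y : Finset (spanning s).ConnectedComponent) :
    compMonomial Y ∈ homogeneousPart V Y.card := by
  classical
  induction Y using Finset.induction_on with
  | empty =>
    intro m h
    simp only [compMonomial, Finset.prod_empty, coeff_one, ne_eq, ite_eq_right_iff,
      one_ne_zero, imp_false, not_not] at h
    simp [← h]
  | insert c Y hc ih =>
    rw [compMonomial, Finset.prod_insert hc, Finset.card_insert_of_notMem hc]
    exact_mod_cast X_mul_mem_homogeneousPart ih (compRep c)

/-- The coefficient of a set of components, for a polynomial in the vertices. -/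
def compCoeff {s : Finset (Sym2 V)} (Y : Finset (spanning s).ConnectedComponent) :
    MvPolynomial V ℤ →ₗ[ℤ] ℤ :=
  lcoeff ℤ (sqfreeExp Y) ∘ₗ (rename (R := ℤ) (spanning s).connectedComponentMk).toLinearMap

theorem compCoeff_apply {s : Finset (Sym2 V)} (Y : Finset (spanning s).ConnectedComponent)
    (p : MvPolynomial V ℤ) :
    compCoeff Y p = coeff (sqfreeExp Y) (rename (spanning s).connectedComponentMk p) := rfl

/-- Renaming vertices to components kills `X a - X b`, and multiples of a square contribute nothing
to a squarefree coefficient. -/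
theorem compCoeff_eq_zero {s : Finset (Sym2 V)} (Y : Finset (spanning s).ConnectedComponent)
    {p : MvPolynomial V ℤ} (hp : p ∈ relIdeal s) : compCoeff Y p = 0 := by
  refine map_eq_zero_of_mem_relIdeal _ (fun q v => ?_) (fun q a b hab => ?_) hp
  · rw [compCoeff_apply, map_mul, map_pow, rename_X]
    exact coeff_sqfreeExp_mul_X_sq _ _ _
  · have : (spanning s).connectedComponentMk a = (spanning s).connectedComponentMk b := by
      rw [SimpleGraph.ConnectedComponent.eq]
      by_cases h : a = b
      · rw [h]
      · exact SimpleGraph.Adj.reachable ((SimpleGraph.fromEdgeSet_adj _).2 ⟨hab, h⟩)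
    rw [compCoeff_apply, map_mul, map_sub, rename_X, rename_X, this, sub_self, mul_zero, coeff_zero]

open Classical in
theorem compCoeff_compMonomial {s : Finset (Sym2 V)}
    (Y Z : Finset (spanning s).ConnectedComponent) :
    compCoeff Y (compMonomial Z) = if Z = Y then 1 else 0 := by
  rw [compCoeff_apply, compMonomial, map_prod]
  simp only [rename_X, mk_compRep]
  rw [← monomial_sqfreeExp, coeff_monomial]
  simp only [sqfreeExp_injective.eq_iff]

theorem quotient_mk_X_eq {s : Finset (Sym2 V)} {a b : V}
    (h : (spanning s).connectedComponentMk a = (spanning s).connectedComponentMk b) :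
    Ideal.Quotient.mk (relIdeal s) (X a) = Ideal.Quotient.mk (relIdeal s) (X b) :=
  Ideal.Quotient.eq.2 (X_sub_X_mem_relIdeal_of_reachable (SimpleGraph.ConnectedComponent.eq.1 h))

theorem quotient_mk_X_mul_self (s : Finset (Sym2 V)) (a : V) :
    Ideal.Quotient.mk (relIdeal s) (X a) * Ideal.Quotient.mk (relIdeal s) (X a) = 0 := by
  rw [← map_mul, ← sq]
  exact Ideal.Quotient.eq_zero_iff_mem.2 (X_sq_mem_relIdeal s a)

/-- Modulo the relations, a monomial is zero or a product over distinct components. -/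
theorem monomial_mem_relIdeal_or (s : Finset (Sym2 V)) (m : V →₀ ℕ) :
    (monomial m 1 : MvPolynomial V ℤ) ∈ relIdeal s ∨
      ∃ Y : Finset (spanning s).ConnectedComponent, Y.card = m.degree ∧
        (monomial m 1 : MvPolynomial V ℤ) - compMonomial Y ∈ relIdeal s := by
  classical
  obtain ⟨t, rfl⟩ := Multiset.toFinsupp.surjective m
  induction t using Multiset.induction_on with
  | empty => exact Or.inr ⟨∅, by simp, by simp [compMonomial]⟩
  | cons v t ih =>
    have hv : (monomial (Multiset.toFinsupp (v ::ₘ t)) 1 : MvPolynomial V ℤ) =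
        X v * monomial (Multiset.toFinsupp t) 1 := by
      rw [← Multiset.singleton_add, map_add, Multiset.toFinsupp_singleton, X, monomial_mul, one_mul]
    rw [hv]
    rcases ih with ih | ⟨Y, hY, ih⟩
    · exact Or.inl (Ideal.mul_mem_left _ _ ih)
    · have hmk : Ideal.Quotient.mk (relIdeal s) (X v) =
          Ideal.Quotient.mk (relIdeal s)
            (X (compRep ((spanning s).connectedComponentMk v))) :=
        quotient_mk_X_eq (mk_compRep _).symm
      have ih' := Ideal.Quotient.eq.2 ih
      by_cases hc : (spanning s).connectedComponentMk v ∈ Y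
      · left
        rw [← Ideal.Quotient.eq_zero_iff_mem, map_mul, ih', compMonomial, map_prod,
          ← Finset.mul_prod_erase Y _ hc, ← mul_assoc, hmk, quotient_mk_X_mul_self, zero_mul]
      · right
        refine ⟨insert ((spanning s).connectedComponentMk v) Y, ?_, ?_⟩
        · rw [Finset.card_insert_of_notMem hc, hY, ← Multiset.singleton_add, map_add, map_add,
            Multiset.toFinsupp_singleton, Finsupp.degree_single, add_comm]
        · rw [← Ideal.Quotient.eq, map_mul, ih', hmk, compMonomial, compMonomial,
            Finset.prod_insert hc, map_mul]

theorem quotient_mk_compMonomial {s : Finset (Sym2 V)} (e : Sym2 V)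
    (Y : Finset (spanning s).ConnectedComponent) :
    Ideal.Quotient.mk (relIdeal (insert e s)) (compMonomial Y) =
      ∏ c ∈ Y, Ideal.Quotient.mk (relIdeal (insert e s)) (X (compRep (compMap s e c))) := by
  rw [compMonomial, map_prod]
  refine Finset.prod_congr rfl fun c _ => quotient_mk_X_eq ?_
  rw [mk_compRep]
  conv_rhs => rw [← mk_compRep c]
  rfl

-- A representative of a component can be replaced, modulo the larger ideal, by that of the
-- component it lands in. Injectivity keeps the factors distinct.
open Classical in
theorem compMonomial_sub_mem_relIdeal {s : Finset (Sym2 V)} {e : Sym2 V}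
    {Y : Finset (spanning s).ConnectedComponent}
    (h : Set.InjOn (compMap s e) (Y : Set (spanning s).ConnectedComponent)) :
    compMonomial Y - compMonomial (Y.image (compMap s e)) ∈ relIdeal (insert e s) := by
  rw [← Ideal.Quotient.eq, quotient_mk_compMonomial, compMonomial, Finset.prod_image h, map_prod]

/-- Two `x`-coloured components that merge produce the square of a variable, matching `x² = 0`. -/
theorem compMonomial_mem_relIdeal {s : Finset (Sym2 V)} {e : Sym2 V}
    {Y : Finset (spanning s).ConnectedComponent}
    (h : ¬ Set.InjOn (compMap s e) (Y : Set (spanning s).ConnectedComponent)) :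
    compMonomial Y ∈ relIdeal (insert e s) := by
  classical
  rw [← Ideal.Quotient.eq_zero_iff_mem, quotient_mk_compMonomial]
  simp only [Set.InjOn, not_forall] at h
  obtain ⟨c, hc, c', hc', hcc', hne⟩ := h
  rw [← Finset.mul_prod_erase Y _ hc,
    ← Finset.mul_prod_erase (Y.erase c) _ (Finset.mem_erase.2 ⟨Ne.symm hne, hc'⟩), ← mul_assoc,
    hcc', quotient_mk_X_mul_self, zero_mul]

variable {G : SimpleGraph V}

theorem single_mem_nullChains {s : Finset (Sym2 V)} {p : MvPolynomial V ℤ}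
    (h : (s : Set (Sym2 V)) ⊆ G.edgeSet → p ∈ relIdeal s) :
    (Pi.single s p : PreChain V) ∈ nullChains G := by
  intro t ht
  by_cases hst : t = s
  · subst hst
    rw [Pi.single_eq_same]
    exact h ht
  · rw [Pi.single_eq_of_ne hst]
    exact Ideal.zero_mem _

/-- The family of polynomials represented by an enhanced state. -/
def stateFamily (S : EnhancedState G) : PreChain V := Pi.single S.s (compMonomial S.xs)

/-- The comparison map from the chromatic complex to the polynomial model. -/
def toModel (G : SimpleGraph V) (i : ℕ) (j : ℤ) :
    (OfBidegree G i j →₀ ℤ) →ₗ[ℤ] PreChain V :=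
  Finsupp.linearCombination ℤ fun S => stateFamily S.1

theorem toModel_single {i : ℕ} {j : ℤ} (S : OfBidegree G i j) (a : ℤ) :
    toModel G i j (Finsupp.single S a) = a • stateFamily S.1 :=
  Finsupp.linearCombination_single _ _ _

theorem stateFamily_mem_bidegreePart {i : ℕ} {j : ℤ} (S : OfBidegree G i j) :
    stateFamily S.1 ∈ bidegreePart V i j := by
  intro s
  by_cases hs : s = S.1.s
  · subst hs
    rw [stateFamily, Pi.single_eq_same]
    refine ⟨fun _ => by exact_mod_cast S.2.1, ?_⟩
    have h := compMonomial_mem_homogeneousPart S.1.xs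
    rwa [S.2.2] at h
  · rw [stateFamily, Pi.single_eq_of_ne hs]
    exact ⟨fun h => absurd rfl h, Submodule.zero_mem _⟩

theorem toModel_mem_bidegreePart {i : ℕ} {j : ℤ} (c : OfBidegree G i j →₀ ℤ) :
    toModel G i j c ∈ bidegreePart V i j :=
  Submodule.sum_mem _ fun S _ => Submodule.smul_mem _ _ (stateFamily_mem_bidegreePart S)

/-- The functionals `compCoeff` are dual to the enhanced states, which makes the comparison map
injective modulo `nullChains`. -/
theorem compCoeff_toModel {i : ℕ} {j : ℤ} (S : OfBidegree G i j) (c : OfBidegree G i j →₀ ℤ) :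
    compCoeff S.1.xs (toModel G i j c S.1.s) = c S := by
  classical
  induction c using Finsupp.induction_linear with
  | zero => simp
  | add c c' h h' => rw [map_add, Pi.add_apply, map_add, h, h', Finsupp.add_apply]
  | single S' a =>
    rw [toModel_single, Pi.smul_apply, map_smul, Finsupp.single_apply, stateFamily]
    obtain ⟨⟨s, hs, xs⟩, hS⟩ := S
    obtain ⟨⟨s', hs', xs'⟩, hS'⟩ := S'
    by_cases h : s = s'
    · subst h
      simp [compCoeff_compMonomial]
    · simp [h, Ne.symm h]

theorem eq_zero_of_toModel_mem {i : ℕ} {j : ℤ} {c : OfBidegree G i j →₀ ℤ}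
    (h : toModel G i j c ∈ nullChains G) : c = 0 := by
  ext S
  rw [← compCoeff_toModel S c]
  exact compCoeff_eq_zero _ (h _ S.1.s_subset)

variable [Fintype V]

/-- Surjectivity modulo `nullChains`: values off the edges of `G` are irrelevant, and each monomial
reduces to zero or to the monomial of an enhanced state. -/
theorem exists_toModel_sub_mem {i : ℕ} {j : ℤ} {f : PreChain V} (hf : f ∈ bidegreePart V i j) :
    ∃ c, toModel G i j c - f ∈ nullChains G := by
  suffices h : f ∈ LinearMap.range (toModel G i j) ⊔ nullChains G by
    obtain ⟨_, ⟨c, rfl⟩, z, hz, rfl⟩ := Submodule.mem_sup.1 h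
    exact ⟨c, by simpa using hz⟩
  rw [← Finset.univ_sum_single f]
  refine Submodule.sum_mem _ fun s _ => ?_
  by_cases hs : (s : Set (Sym2 V)) ⊆ G.edgeSet
  swap
  · exact Submodule.mem_sup_right (single_mem_nullChains fun h => absurd h hs)
  by_cases h0 : f s = 0
  · rw [h0, Pi.single_zero]
    exact Submodule.zero_mem _
  have hcard : s.card = i := by exact_mod_cast (hf s).1 h0
  rw [← LinearMap.coe_single ℤ (fun _ : Finset (Sym2 V) => MvPolynomial V ℤ), (f s).as_sum, map_sum]
  refine Submodule.sum_mem _ fun m hm => ?_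
  have hdeg := (hf s).2 m (mem_support_iff.1 hm)
  have hmon : (monomial m (coeff m (f s)) : MvPolynomial V ℤ) = coeff m (f s) • monomial m 1 := by
    rw [smul_monomial, smul_eq_mul, mul_one]
  rw [hmon, map_smul]
  refine Submodule.smul_mem _ _ ?_
  rcases monomial_mem_relIdeal_or s m with h | ⟨Y, hY, h⟩
  · exact Submodule.mem_sup_right (single_mem_nullChains fun _ => h)
  · rw [← sub_add_cancel (monomial m (1 : ℤ)) (compMonomial Y), map_add]
    refine Submodule.add_mem _ (Submodule.mem_sup_right (single_mem_nullChains fun _ => h)) ?_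
    refine Submodule.mem_sup_left ⟨Finsupp.single ⟨⟨s, hs, Y⟩, hcard, ?_⟩ 1, ?_⟩
    · rw [← hdeg, hY]
    · rw [toModel_single, one_smul]
      rfl

/-- `preDiff` is defined by removing edges from the target; this rewrites it as adding edges to the
source, the form used by `diffState`. -/
theorem preDiff_single (s : Finset (Sym2 V)) (p : MvPolynomial V ℤ) :
    preDiff (Pi.single s p : PreChain V) =
      ∑ e : Sym2 V,
        if e ∉ s then edgeSign s e • (Pi.single (insert e s) p : PreChain V) else 0 := by
  classical
  funext t
  rw [preDiff_apply, Finset.sum_apply, ← Finset.sum_filter_of_ne (p := fun e => e ∉ s)]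
  swap
  · intro e _ he
    by_contra h
    have hne : t.erase e ≠ s := fun h' => Finset.notMem_erase e t (h'.symm ▸ h)
    rw [Pi.single_eq_of_ne hne, smul_zero] at he
    exact he rfl
  rw [← Finset.sum_subset (Finset.subset_univ (t.filter fun e => e ∉ s))]
  · refine Finset.sum_congr rfl fun e he => ?_
    obtain ⟨het, hes⟩ := Finset.mem_filter.1 he
    rw [if_pos hes, Pi.smul_apply]
    by_cases h : t.erase e = s
    · subst h
      rw [Finset.insert_erase het, Pi.single_eq_same, Pi.single_eq_same]
    · have h' : t ≠ insert e s := fun h' => h (by rw [h', Finset.erase_insert hes])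
      rw [Pi.single_eq_of_ne h, Pi.single_eq_of_ne h', smul_zero, smul_zero]
  · intro e _ he
    split_ifs with hes
    · rfl
    · have h' : t ≠ insert e s := fun h' =>
        he (Finset.mem_filter.2 ⟨by rw [h']; exact Finset.mem_insert_self _ _, hes⟩)
      rw [Pi.smul_apply, Pi.single_eq_of_ne h', smul_zero]

theorem preDiff_stateFamily_sub_mem {i : ℕ} {j : ℤ} (S : OfBidegree G i j) :
    preDiff (stateFamily S.1) - toModel G (i + 1) j (diffState S) ∈ nullChains G := by
  classical
  rw [stateFamily, preDiff_single, diffState, map_sum, ← Finset.sum_sub_distrib]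
  refine Submodule.sum_mem _ fun e _ => ?_
  by_cases hes : e ∈ S.1.s
  · rw [if_neg (not_not.2 hes), dif_neg fun h => h.2.1 hes, map_zero, sub_zero]
    exact Submodule.zero_mem _
  rw [if_pos hes]
  by_cases heG : e ∈ G.edgeSet
  swap
  · rw [dif_neg fun h => heG h.1, map_zero, sub_zero]
    exact Submodule.smul_mem _ _ (single_mem_nullChains fun h => absurd (h (by simp)) heG)
  by_cases hS : S.1.Survives e
  · rw [dif_pos ⟨heG, hes, hS⟩, toModel_single, edgeSign, ← smul_sub, stateFamily]
    refine Submodule.smul_mem _ _ ?_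
    have := single_mem_nullChains (G := G) fun _ => compMonomial_sub_mem_relIdeal hS
    rw [Pi.single_sub] at this
    exact this
  · rw [dif_neg fun h => hS h.2.2, map_zero, sub_zero]
    exact Submodule.smul_mem _ _ (single_mem_nullChains fun _ => compMonomial_mem_relIdeal hS)

theorem preDiff_toModel_sub_mem {i : ℕ} {j : ℤ} (c : Chain G i j) :
    preDiff (toModel G i j c) - toModel G (i + 1) j (diff G i j c) ∈ nullChains G := by
  induction c using Finsupp.induction_linear with
  | zero => simp
  | add c c' h h' =>
    rw [map_add, map_add, map_add, map_add, add_sub_add_comm]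
    exact Submodule.add_mem _ h h'
  | single S a =>
    rw [toModel_single, map_smul, diff, Finsupp.linearCombination_single, map_smul, ← smul_sub]
    exact Submodule.smul_mem _ _ (preDiff_stateFamily_sub_mem S)

/-- In degree zero the model's primitives have edge degree `-1` and hence vanish, in agreement with
`C^{-1,j} = 0`. In positive degree a primitive is lifted to a chain and injectivity modulo
`nullChains` applies. -/
theorem mem_boundaries_iff {i : ℕ} {j : ℤ} (c : Chain G i j) :
    toModel G i j c ∈ modelBoundaries G i j ↔ c ∈ boundaries G i j := by
  rw [mem_modelBoundaries]
  cases i with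
  | zero =>
    rw [boundaries, Submodule.mem_bot]
    constructor
    · rintro ⟨y, hy, h⟩
      rw [eq_zero_of_mem_bidegreePart_of_neg hy (by simp), map_zero, sub_zero] at h
      exact eq_zero_of_toModel_mem h
    · rintro rfl
      exact ⟨0, Submodule.zero_mem _, by simp⟩
  | succ i =>
    rw [boundaries, LinearMap.mem_range]
    have hi : ((i + 1 : ℕ) : ℤ) - 1 = i := by simp
    rw [hi]
    constructor
    · rintro ⟨y, hy, h⟩
      obtain ⟨b, hb⟩ := exists_toModel_sub_mem (G := G) hy
      refine ⟨b, (sub_eq_zero.1 (eq_zero_of_toModel_mem (G := G) ?_)).symm⟩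
      have h1 := preDiff_mem_nullChains hb
      have h2 := preDiff_toModel_sub_mem b
      rw [map_sub] at h1
      rw [map_sub]
      convert Submodule.sub_mem _ (Submodule.add_mem _ h h2) h1 using 1
      abel
    · rintro ⟨b, rfl⟩
      refine ⟨_, toModel_mem_bidegreePart b, ?_⟩
      simpa using Submodule.neg_mem _ (preDiff_toModel_sub_mem b)

/-- Chromatic homology is the homology of the polynomial model. -/
def homologyEquivModel (G : SimpleGraph V) (i : ℕ) (j : ℤ) : H G i j ≃ₗ[ℤ] ModelHomology G i j :=
  subquotientCongr _ _ _ _ (toModel G i j)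
    (by
      intro c hc
      refine ⟨toModel_mem_bidegreePart c, ?_⟩
      have := preDiff_toModel_sub_mem c
      rwa [LinearMap.mem_ker.1 hc, map_zero, sub_zero] at this)
    (fun c _ => mem_boundaries_iff c)
    (by
      rintro f ⟨hf, hdf⟩
      obtain ⟨c, hc⟩ := exists_toModel_sub_mem (G := G) hf
      refine ⟨c, ?_, Submodule.mem_sup_right hc⟩
      refine LinearMap.mem_ker.2 (eq_zero_of_toModel_mem (G := G) ?_)
      have h1 := preDiff_mem_nullChains hc
      have h2 := preDiff_toModel_sub_mem c
      rw [map_sub] at h1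
      convert Submodule.sub_mem _ (Submodule.add_mem _ h1 hdf) h2 using 1
      abel)

end Comparison

/-! ### Removing the first vertex of a complete graph -/

section Edges

variable {m : ℕ}

/-- The inclusion of the edges of `K m` into the edges of `K (m + 1)` avoiding the vertex `0`. -/
def succEdge (m : ℕ) : Sym2 (Fin m) ↪ Sym2 (Fin (m + 1)) := (Fin.succEmb m).sym2Map

/-- An edge set of `K m`, regarded as an edge set of `K (m + 1)` avoiding the vertex `0`. -/
def succEdges (s : Finset (Sym2 (Fin m))) : Finset (Sym2 (Fin (m + 1))) := s.map (succEdge m)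

/-- The edge set of `K (m + 1)` consisting of `s` and the edge from `0` to `k`. -/
def starEdges (k : Fin m) (s : Finset (Sym2 (Fin m))) : Finset (Sym2 (Fin (m + 1))) :=
  insert s(0, k.succ) (succEdges s)

@[simp]
theorem succEdge_mk (a b : Fin m) : succEdge m s(a, b) = s(a.succ, b.succ) := rfl

theorem zero_notMem_succEdge (e : Sym2 (Fin m)) : 0 ∉ succEdge m e := by
  induction e with | h a b =>
  simp [(Fin.succ_ne_zero _).symm]

theorem zero_notMem_of_mem_succEdges {s : Finset (Sym2 (Fin m))} {e : Sym2 (Fin (m + 1))}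
    (he : e ∈ succEdges s) : 0 ∉ e := by
  obtain ⟨e', _, rfl⟩ := Finset.mem_map.1 he
  exact zero_notMem_succEdge e'

theorem star_notMem_succEdges (k : Fin m) (s : Finset (Sym2 (Fin m))) :
    s(0, k.succ) ∉ succEdges s := fun h => zero_notMem_of_mem_succEdges h (by simp)

theorem succEdges_erase (s : Finset (Sym2 (Fin m))) (e : Sym2 (Fin m)) :
    (succEdges s).erase (succEdge m e) = succEdges (s.erase e) := (Finset.map_erase _ _ _).symm

theorem mk_mem_succEdges {s : Finset (Sym2 (Fin m))} {a b : Fin (m + 1)} :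
    s(a, b) ∈ succEdges s ↔ ∃ a' b', a = Fin.succ a' ∧ b = Fin.succ b' ∧ s(a', b') ∈ s := by
  constructor
  · intro h
    obtain ⟨e, he, heq⟩ := Finset.mem_map.1 h
    induction e with | h c d =>
    rw [succEdge_mk] at heq
    rcases Sym2.eq_iff.1 heq with ⟨rfl, rfl⟩ | ⟨rfl, rfl⟩
    · exact ⟨c, d, rfl, rfl, he⟩
    · exact ⟨d, c, rfl, rfl, Sym2.eq_swap ▸ he⟩
  · rintro ⟨a, b, rfl, rfl, h⟩
    exact Finset.mem_map_of_mem (succEdge m) h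

theorem edgeLT_succEdge {e f : Sym2 (Fin m)} :
    EdgeLT (succEdge m e) (succEdge m f) ↔ EdgeLT e f := by
  have hinf : ∀ e : Sym2 (Fin m), (succEdge m e).inf = e.inf.succ := fun e => by
    induction e with | h a b => exact (Fin.strictMono_succ.monotone.map_min).symm
  have hsup : ∀ e : Sym2 (Fin m), (succEdge m e).sup = e.sup.succ := fun e => by
    induction e with | h a b => exact (Fin.strictMono_succ.monotone.map_max).symm
  simp [EdgeLT, Prod.Lex.toLex_lt_toLex, hinf, hsup]

theorem edgeLT_star_succEdge (k : Fin m) (e : Sym2 (Fin m)) :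
    EdgeLT s(0, k.succ) (succEdge m e) := by
  induction e with | h a b =>
  refine Prod.Lex.toLex_lt_toLex.2 (Or.inl ?_)
  simp [Fin.succ_pos]

theorem numBefore_succEdges (s : Finset (Sym2 (Fin m))) (e : Sym2 (Fin m)) :
    numBefore (succEdges s) (succEdge m e) = numBefore s e := by
  rw [numBefore, numBefore, ← Set.ncard_image_of_injective _ (succEdge m).injective]
  congr 1
  ext f
  constructor
  · rintro ⟨hf, hlt⟩
    obtain ⟨f', hf', rfl⟩ := Finset.mem_map.1 hf
    exact ⟨f', ⟨hf', edgeLT_succEdge.1 hlt⟩, rfl⟩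
  · rintro ⟨f', ⟨hf', hlt⟩, rfl⟩
    exact ⟨Finset.mem_map_of_mem _ hf', edgeLT_succEdge.2 hlt⟩

theorem edgeSign_succEdges (s : Finset (Sym2 (Fin m))) (e : Sym2 (Fin m)) :
    edgeSign (succEdges s) (succEdge m e) = edgeSign s e := by
  rw [edgeSign, edgeSign, numBefore_succEdges]

/-- Every edge at `0` precedes lexicographically every edge avoiding `0`, so the star edge raises
the count by one. -/
theorem edgeSign_starEdges (k : Fin m) (s : Finset (Sym2 (Fin m))) (e : Sym2 (Fin m)) :
    edgeSign (starEdges k s) (succEdge m e) = -edgeSign s e := by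
  rw [edgeSign, starEdges, numBefore_insert (star_notMem_succEdges k s),
    if_pos (edgeLT_star_succEdge k e), numBefore_succEdges, pow_succ, edgeSign]
  ring

theorem edgeSign_succEdges_star (k : Fin m) (s : Finset (Sym2 (Fin m))) :
    edgeSign (succEdges s) s(0, k.succ) = 1 := by
  have : {f | f ∈ succEdges s ∧ EdgeLT f s(0, k.succ)} = ∅ := by
    refine Set.eq_empty_of_forall_notMem ?_
    rintro f ⟨hf, hlt⟩
    obtain ⟨f', _, rfl⟩ := Finset.mem_map.1 hf
    exact lt_asymm hlt (edgeLT_star_succEdge k f')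
  rw [edgeSign, numBefore, this, Set.ncard_empty, pow_zero]

theorem subset_edgeSet_K {n : ℕ} {s : Finset (Sym2 (Fin n))} :
    (s : Set (Sym2 (Fin n))) ⊆ (K n).edgeSet ↔ ∀ e ∈ s, ¬ e.IsDiag := by
  simp only [Set.subset_def, Finset.mem_coe, SimpleGraph.edgeSet_top, Set.mem_compl_iff]
  rfl

theorem succEdges_subset_iff {s : Finset (Sym2 (Fin m))} :
    (succEdges s : Set (Sym2 (Fin (m + 1)))) ⊆ (K (m + 1)).edgeSet ↔
      (s : Set (Sym2 (Fin m))) ⊆ (K m).edgeSet := by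
  have : ∀ e : Sym2 (Fin m), (succEdge m e).IsDiag ↔ e.IsDiag := fun e => by
    induction e with | h a b => simp
  rw [subset_edgeSet_K, subset_edgeSet_K]
  simp only [succEdges, Finset.forall_mem_map, this]

theorem starEdges_subset_iff {k : Fin m} {s : Finset (Sym2 (Fin m))} :
    (starEdges k s : Set (Sym2 (Fin (m + 1)))) ⊆ (K (m + 1)).edgeSet ↔
      (s : Set (Sym2 (Fin m))) ⊆ (K m).edgeSet := by
  rw [← succEdges_subset_iff (s := s), starEdges, Finset.coe_insert, Set.insert_subset_iff,
    and_iff_right]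
  simp [(Fin.succ_ne_zero _).symm]

theorem card_succEdges (s : Finset (Sym2 (Fin m))) : (succEdges s).card = s.card :=
  Finset.card_map _

theorem card_starEdges (k : Fin m) (s : Finset (Sym2 (Fin m))) :
    (starEdges k s).card = s.card + 1 := by
  rw [starEdges, Finset.card_insert_of_notMem (star_notMem_succEdges k s), card_succEdges]

theorem succEdges_injective : Function.Injective (succEdges (m := m)) :=
  Finset.map_injective _

theorem starEdges_injective (k : Fin m) : Function.Injective (starEdges k) := by
  intro s t h
  apply succEdges_injective
  rw [← Finset.erase_insert (star_notMem_succEdges k s), ← starEdges, h, starEdges,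
    Finset.erase_insert (star_notMem_succEdges k t)]

theorem starEdges_ne_succEdges (k : Fin m) (s t : Finset (Sym2 (Fin m))) :
    starEdges k s ≠ succEdges t := fun h =>
  star_notMem_succEdges k t (h ▸ Finset.mem_insert_self _ _)

theorem starEdges_ne_starEdges {k l : Fin m} (hkl : k ≠ l) (s t : Finset (Sym2 (Fin m))) :
    starEdges k s ≠ starEdges l t := by
  intro h
  have : s(0, k.succ) ∈ starEdges l t := h ▸ Finset.mem_insert_self _ _
  rcases Finset.mem_insert.1 this with heq | hmem
  · rcases Sym2.eq_iff.1 heq with ⟨_, heq⟩ | ⟨heq, _⟩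
    · exact hkl (Fin.succ_injective _ heq)
    · exact Fin.succ_ne_zero _ heq.symm
  · exact star_notMem_succEdges k t hmem

/-- The edges at the vertex `0`. -/
def star (s : Finset (Sym2 (Fin (m + 1)))) : Finset (Sym2 (Fin (m + 1))) := s.filter (0 ∈ ·)

theorem star_succEdges (s : Finset (Sym2 (Fin m))) : star (succEdges s) = ∅ :=
  Finset.filter_eq_empty_iff.2 fun _ => zero_notMem_of_mem_succEdges

theorem star_insert_of_notMem {e : Sym2 (Fin (m + 1))} (he : 0 ∉ e)
    (s : Finset (Sym2 (Fin (m + 1)))) : star (insert e s) = star s := by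
  rw [star, Finset.filter_insert, if_neg he, star]

theorem star_erase_of_notMem {e : Sym2 (Fin (m + 1))} (he : 0 ∉ e)
    (s : Finset (Sym2 (Fin (m + 1)))) : star (s.erase e) = star s := by
  rw [star, Finset.filter_erase, Finset.erase_eq_of_notMem, star]
  exact fun h => he (Finset.mem_filter.1 h).2

theorem card_star_erase_lt {e : Sym2 (Fin (m + 1))} (he : 0 ∈ e)
    {s : Finset (Sym2 (Fin (m + 1)))} (hes : e ∈ s) : (star (s.erase e)).card < (star s).card := by
  rw [star, Finset.filter_erase]
  exact Finset.card_erase_lt_of_mem (Finset.mem_filter.2 ⟨hes, he⟩)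

theorem card_star_starEdges (k : Fin m) (s : Finset (Sym2 (Fin m))) :
    (star (starEdges k s)).card = 1 := by
  rw [starEdges, star, Finset.filter_insert, if_pos (by simp), ← star, star_succEdges]
  rfl

theorem exists_succEdges_of_star_eq_empty {s : Finset (Sym2 (Fin (m + 1)))} (hs : star s = ∅) :
    ∃ t, s = succEdges t := by
  suffices h : ∃ t : Finset (Sym2 (Fin m)), t.map (succEdge m) = s by
    obtain ⟨t, ht⟩ := h
    exact ⟨t, ht.symm⟩
  refine ⟨s.preimage (succEdge m) (succEdge m).injective.injOn, ?_⟩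
  ext e
  simp only [Finset.mem_map, Finset.mem_preimage]
  constructor
  · rintro ⟨e, he, rfl⟩
    exact he
  · intro he
    have h0 := Finset.filter_eq_empty_iff.1 hs he
    induction e with | h a b =>
    simp only [Sym2.mem_iff, not_or] at h0
    obtain ⟨a, rfl⟩ := Fin.exists_succ_eq.2 (Ne.symm h0.1)
    obtain ⟨b, rfl⟩ := Fin.exists_succ_eq.2 (Ne.symm h0.2)
    exact ⟨s(a, b), he, rfl⟩

theorem exists_eq_star_of_mem {e : Sym2 (Fin (m + 1))} (h0 : 0 ∈ e) (he : ¬ e.IsDiag) :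
    ∃ k : Fin m, e = s(0, k.succ) := by
  obtain ⟨b, rfl⟩ := h0
  have hb : b ≠ 0 := fun h => he (by simp [h])
  obtain ⟨k, rfl⟩ := Fin.exists_succ_eq.2 hb
  exact ⟨k, rfl⟩

theorem exists_starEdges_of_card_star_eq_one {s : Finset (Sym2 (Fin (m + 1)))}
    (hs : (s : Set (Sym2 (Fin (m + 1)))) ⊆ (K (m + 1)).edgeSet) (h1 : (star s).card = 1) :
    ∃ k t, s = starEdges k t := by
  obtain ⟨e, he⟩ := Finset.card_eq_one.1 h1
  have hmem : e ∈ star s := by simp [he]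
  obtain ⟨hes, h0⟩ := Finset.mem_filter.1 hmem
  obtain ⟨k, rfl⟩ := exists_eq_star_of_mem h0 (subset_edgeSet_K.1 hs e hes)
  obtain ⟨t, ht⟩ := exists_succEdges_of_star_eq_empty (s := s.erase s(0, k.succ))
    (Finset.card_eq_zero.1 (by have := card_star_erase_lt h0 hes; omega))
  exact ⟨k, t, by rw [starEdges, ← ht, Finset.insert_erase hes]⟩

theorem exists_two_star_edges {s : Finset (Sym2 (Fin (m + 1)))}
    (hs : (s : Set (Sym2 (Fin (m + 1)))) ⊆ (K (m + 1)).edgeSet) (h2 : 2 ≤ (star s).card) :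
    ∃ k l : Fin m, k ≠ l ∧ s(0, k.succ) ∈ star s ∧ s(0, l.succ) ∈ star s := by
  obtain ⟨e, he, f, hf, hne⟩ := Finset.one_lt_card.1 h2
  obtain ⟨hes, he0⟩ := Finset.mem_filter.1 he
  obtain ⟨hfs, hf0⟩ := Finset.mem_filter.1 hf
  obtain ⟨k, rfl⟩ := exists_eq_star_of_mem he0 (subset_edgeSet_K.1 hs e hes)
  obtain ⟨l, rfl⟩ := exists_eq_star_of_mem hf0 (subset_edgeSet_K.1 hs f hfs)
  exact ⟨k, l, fun h => hne (by rw [h]), he, hf⟩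

end Edges

/-! ### Relation ideals when the vertex `0` is isolated or a leaf -/

section Ideals

variable {V W : Type} [LinearOrder V] [LinearOrder W]

theorem rename_mem_relIdeal {s : Finset (Sym2 V)} {t : Finset (Sym2 W)} (g : V → W)
    (h : ∀ a b, s(a, b) ∈ s → (X (g a) - X (g b) : MvPolynomial W ℤ) ∈ relIdeal t)
    {p : MvPolynomial V ℤ} (hp : p ∈ relIdeal s) : rename g p ∈ relIdeal t := by
  refine relIdeal_le (I := (relIdeal t).comap (rename (R := ℤ) g)) (fun v => ?_)
    (fun a b hab => ?_) hp
  · rw [Ideal.mem_comap, map_pow, rename_X]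
    exact X_sq_mem_relIdeal t _
  · rw [Ideal.mem_comap, map_sub, rename_X, rename_X]
    exact h a b hab

theorem sub_rename_mem_relIdeal {s : Finset (Sym2 V)} (g : V → V)
    (h : ∀ v, (X v - X (g v) : MvPolynomial V ℤ) ∈ relIdeal s) (p : MvPolynomial V ℤ) :
    p - rename g p ∈ relIdeal s := by
  rw [← Ideal.Quotient.eq]
  have : (Ideal.Quotient.mkₐ ℤ (relIdeal s)) = (Ideal.Quotient.mkₐ ℤ (relIdeal s)).comp
      (rename g) := by
    refine algHom_ext fun v => ?_
    rw [AlgHom.comp_apply, rename_X]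
    exact Ideal.Quotient.eq.2 (h v)
  exact DFunLike.congr_fun this p

variable {m : ℕ}

theorem finSuccEquiv_rename_succ (p : MvPolynomial (Fin m) ℤ) :
    finSuccEquiv ℤ m (rename Fin.succ p) = Polynomial.C p := by
  induction p using MvPolynomial.induction_on with
  | C a => simp
  | add p q hp hq => simp only [map_add, hp, hq]
  | mul_X p v hp => rw [map_mul, map_mul, hp, rename_X, finSuccEquiv_X_succ, map_mul]

/-- The expansion of a polynomial in the variable `X 0` up to second order. -/
theorem exists_eq_add_X_zero_sq_mul (p : MvPolynomial (Fin (m + 1)) ℤ) :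
    ∃ r, p = rename Fin.succ ((finSuccEquiv ℤ m p).coeff 0) +
      X 0 * rename Fin.succ ((finSuccEquiv ℤ m p).coeff 1) + X 0 ^ 2 * r := by
  set P := finSuccEquiv ℤ m p with hP
  refine ⟨(finSuccEquiv ℤ m).symm P.divX.divX, (finSuccEquiv ℤ m).injective ?_⟩
  rw [map_add, map_add, map_mul, map_mul, map_pow, finSuccEquiv_rename_succ,
    finSuccEquiv_rename_succ, finSuccEquiv_X_zero, AlgEquiv.apply_symm_apply, ← hP]
  have h1 := P.divX_mul_X_add
  have h2 := P.divX.divX_mul_X_add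
  rw [Polynomial.coeff_divX, zero_add] at h2
  nth_rewrite 1 [← h1, ← h2]
  ring

theorem rename_succ_mem_relIdeal {s : Finset (Sym2 (Fin m))} {p : MvPolynomial (Fin m) ℤ}
    (hp : p ∈ relIdeal s) : rename Fin.succ p ∈ relIdeal (succEdges s) :=
  rename_mem_relIdeal _ (fun a b hab => X_sub_X_mem_relIdeal
    (mk_mem_succEdges.2 ⟨a, b, rfl, rfl, hab⟩)) hp

/-- With `0` isolated the only relation on `X 0` is its square being zero, so the coefficients of
order zero and one decide membership independently. -/
theorem mem_relIdeal_succEdges_iff {s : Finset (Sym2 (Fin m))}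
    {p : MvPolynomial (Fin (m + 1)) ℤ} :
    p ∈ relIdeal (succEdges s) ↔
      (finSuccEquiv ℤ m p).coeff 0 ∈ relIdeal s ∧ (finSuccEquiv ℤ m p).coeff 1 ∈ relIdeal s := by
  constructor
  · intro hp
    refine Submodule.span_induction ?_ ?_ ?_ ?_ hp
    · rintro p (⟨v, rfl⟩ | ⟨a, b, hab, rfl⟩)
      · cases v using Fin.cases with
        | zero => simp [finSuccEquiv_X_zero, Polynomial.coeff_X_pow]
        | succ v =>
          rw [map_pow, finSuccEquiv_X_succ, ← map_pow, Polynomial.coeff_C_zero,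
            Polynomial.coeff_C_of_ne_zero one_ne_zero]
          exact ⟨X_sq_mem_relIdeal s v, Ideal.zero_mem _⟩
      · obtain ⟨a, b, rfl, rfl, hab'⟩ := mk_mem_succEdges.1 hab
        rw [map_sub, finSuccEquiv_X_succ, finSuccEquiv_X_succ, ← map_sub,
          Polynomial.coeff_C_zero, Polynomial.coeff_C_of_ne_zero one_ne_zero]
        exact ⟨X_sub_X_mem_relIdeal hab', Ideal.zero_mem _⟩
    · simp
    · intro x y _ _ hx hy
      rw [map_add, Polynomial.coeff_add, Polynomial.coeff_add]
      exact ⟨Ideal.add_mem _ hx.1 hy.1, Ideal.add_mem _ hx.2 hy.2⟩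
    · intro a x _ hx
      rw [smul_eq_mul, map_mul, Polynomial.mul_coeff_zero, Polynomial.mul_coeff_one]
      exact ⟨Ideal.mul_mem_left _ _ hx.1,
        Ideal.add_mem _ (Ideal.mul_mem_left _ _ hx.2) (Ideal.mul_mem_left _ _ hx.1)⟩
  · rintro ⟨h0, h1⟩
    obtain ⟨r, hr⟩ := exists_eq_add_X_zero_sq_mul p
    rw [hr]
    exact Ideal.add_mem _ (Ideal.add_mem _ (rename_succ_mem_relIdeal h0)
      (Ideal.mul_mem_left _ _ (rename_succ_mem_relIdeal h1)))
      (Ideal.mul_mem_right _ _ (X_sq_mem_relIdeal _ _))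

/-- The map of vertices identifying `0` with `k`. -/
def mergeVertex (k : Fin m) : Fin (m + 1) → Fin m := Fin.cases k id

@[simp]
theorem mergeVertex_zero (k : Fin m) : mergeVertex k 0 = k := rfl

@[simp]
theorem mergeVertex_succ (k v : Fin m) : mergeVertex k v.succ = v := rfl

theorem rename_mergeVertex_rename_succ (k : Fin m) (p : MvPolynomial (Fin m) ℤ) :
    rename (mergeVertex k) (rename Fin.succ p) = p := by
  rw [rename_rename]
  exact rename_id_apply p

/-- The star edge identifies `X 0` with the variable of `k`, so `X 0` can be eliminated by
substitution. -/
theorem mem_relIdeal_starEdges_iff {k : Fin m} {s : Finset (Sym2 (Fin m))}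
    {p : MvPolynomial (Fin (m + 1)) ℤ} :
    p ∈ relIdeal (starEdges k s) ↔ rename (mergeVertex k) p ∈ relIdeal s := by
  constructor
  · refine rename_mem_relIdeal _ fun a b hab => ?_
    rcases Finset.mem_insert.1 hab with hab | hab
    · rcases Sym2.eq_iff.1 hab with ⟨rfl, rfl⟩ | ⟨rfl, rfl⟩ <;> simp
    · obtain ⟨a, b, rfl, rfl, hab'⟩ := mk_mem_succEdges.1 hab
      exact X_sub_X_mem_relIdeal hab'
  · intro h
    have h1 := relIdeal_mono (Finset.subset_insert s(0, k.succ) _) (rename_succ_mem_relIdeal h)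
    rw [rename_rename] at h1
    have h2 := sub_rename_mem_relIdeal (s := starEdges k s) (Fin.succ ∘ mergeVertex k)
      (fun v => by
        cases v using Fin.cases with
        | zero => exact X_sub_X_mem_relIdeal (Finset.mem_insert_self _ _)
        | succ v => simp) p
    simpa using Ideal.add_mem _ h2 h1

/-- The substitution turns every term divisible by `X 0 ^ 2` into a multiple of `X k ^ 2`. -/
theorem rename_mergeVertex_sub_mem (k : Fin m) (s : Finset (Sym2 (Fin m)))
    (p : MvPolynomial (Fin (m + 1)) ℤ) :
    rename (mergeVertex k) p -
      ((finSuccEquiv ℤ m p).coeff 0 + X k * (finSuccEquiv ℤ m p).coeff 1) ∈ relIdeal s := by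
  obtain ⟨r, hr⟩ := exists_eq_add_X_zero_sq_mul p
  nth_rewrite 1 [hr]
  simp only [map_add, map_mul, map_pow, rename_mergeVertex_rename_succ, rename_X,
    mergeVertex_zero, add_sub_cancel_left]
  exact Ideal.mul_mem_right _ _ (X_sq_mem_relIdeal s k)

end Ideals

/-! ### Restriction to, and extension from, edge sets with at most one edge at `0` -/

section Restriction

variable {m : ℕ}

/-- The `X 0`-linear part of a family on the edge sets avoiding the vertex `0`. -/
def linearPart : PreChain (Fin (m + 1)) →ₗ[ℤ] PreChain (Fin m) where
  toFun f s := (finSuccEquiv ℤ m (f (succEdges s))).coeff 1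
  map_add' f g := by
    funext s
    simp
  map_smul' a f := by
    funext s
    simp

/-- The part of a family on the edge sets whose only edge at `0` is the one to `k`. -/
def starPart (k : Fin m) : PreChain (Fin (m + 1)) →ₗ[ℤ] PreChain (Fin m) where
  toFun f s := rename (mergeVertex k) (f (starEdges k s))
  map_add' f g := by
    funext s
    simp
  map_smul' a f := by
    funext s
    simp

theorem linearPart_apply (f : PreChain (Fin (m + 1))) (s : Finset (Sym2 (Fin m))) :
    linearPart f s = (finSuccEquiv ℤ m (f (succEdges s))).coeff 1 := rfl

theorem starPart_apply (k : Fin m) (f : PreChain (Fin (m + 1))) (s : Finset (Sym2 (Fin m))) :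
    starPart k f s = rename (mergeVertex k) (f (starEdges k s)) := rfl

theorem preDiff_succEdges (f : PreChain (Fin (m + 1))) (s : Finset (Sym2 (Fin m))) :
    preDiff f (succEdges s) = ∑ e ∈ s, edgeSign (s.erase e) e • f (succEdges (s.erase e)) := by
  rw [preDiff_apply]
  conv_lhs => rw [succEdges, Finset.sum_map]
  refine Finset.sum_congr rfl fun e _ => ?_
  rw [← succEdges, succEdges_erase, edgeSign_succEdges]

theorem preDiff_starEdges (f : PreChain (Fin (m + 1))) (k : Fin m) (s : Finset (Sym2 (Fin m))) :
    preDiff f (starEdges k s) = f (succEdges s) -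
      ∑ e ∈ s, edgeSign (s.erase e) e • f (starEdges k (s.erase e)) := by
  rw [starEdges, preDiff_insert f (star_notMem_succEdges k s), edgeSign_succEdges_star, one_smul,
    sub_eq_add_neg, ← Finset.sum_neg_distrib]
  congr 1
  conv_lhs => rw [succEdges, Finset.sum_map]
  refine Finset.sum_congr rfl fun e _ => ?_
  rw [← succEdges, succEdges_erase, ← starEdges, edgeSign_starEdges, neg_smul]

theorem linearPart_preDiff (f : PreChain (Fin (m + 1))) :
    linearPart (preDiff f) = preDiff (linearPart f) := by
  funext s
  rw [linearPart_apply, preDiff_succEdges, preDiff_apply, map_sum, Polynomial.finsetSum_coeff]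
  refine Finset.sum_congr rfl fun e _ => ?_
  rw [map_zsmul, Polynomial.coeff_smul, linearPart_apply]

theorem starPart_preDiff (k : Fin m) (f : PreChain (Fin (m + 1))) (s : Finset (Sym2 (Fin m))) :
    starPart k (preDiff f) s =
      rename (mergeVertex k) (f (succEdges s)) - preDiff (starPart k f) s := by
  rw [starPart_apply, preDiff_starEdges, preDiff_apply, map_sub, map_sum]
  congr 1
  refine Finset.sum_congr rfl fun e _ => ?_
  rw [map_zsmul, starPart_apply]

variable {i j : ℤ}

theorem linearPart_mem_bidegreePart {f : PreChain (Fin (m + 1))}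
    (hf : f ∈ bidegreePart (Fin (m + 1)) i j) : linearPart f ∈ bidegreePart (Fin m) i (j - 1) := by
  intro s
  refine ⟨fun h => ?_, ?_⟩
  · rw [← card_succEdges]
    refine (hf _).1 fun h0 => h ?_
    rw [linearPart_apply, h0, map_zero, Polynomial.coeff_zero]
  · exact_mod_cast finSuccEquiv_coeff_mem_homogeneousPart (hf (succEdges s)).2 1

theorem starPart_mem_bidegreePart {f : PreChain (Fin (m + 1))}
    (hf : f ∈ bidegreePart (Fin (m + 1)) i j) (k : Fin m) :
    starPart k f ∈ bidegreePart (Fin m) (i - 1) j := by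
  intro s
  refine ⟨fun h => ?_, rename_mem_homogeneousPart (hf _).2 _⟩
  have := (hf (starEdges k s)).1 fun h0 => h (by rw [starPart_apply, h0, map_zero])
  rw [card_starEdges] at this
  push_cast at this
  omega

theorem linearPart_mem_nullChains {f : PreChain (Fin (m + 1))} (hf : f ∈ nullChains (K (m + 1))) :
    linearPart f ∈ nullChains (K m) := fun _ hs =>
  (mem_relIdeal_succEdges_iff.1 (hf _ (succEdges_subset_iff.2 hs))).2

theorem starPart_mem_nullChains {f : PreChain (Fin (m + 1))} (hf : f ∈ nullChains (K (m + 1)))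
    (k : Fin m) : starPart k f ∈ nullChains (K m) := fun _ hs =>
  mem_relIdeal_starEdges_iff.1 (hf _ (starEdges_subset_iff.2 hs))

/-- The family on the edge sets of `K (m + 1)` avoiding `0` given by `F`, and zero elsewhere. -/
def extendSucc (F : Finset (Sym2 (Fin m)) → MvPolynomial (Fin (m + 1)) ℤ) :
    PreChain (Fin (m + 1)) := Function.extend succEdges F 0

/-- The family given by `F` on the edge sets whose only edge at `0` is the one to `k`, and zero
elsewhere. -/
def extendStar (k : Fin m) (F : Finset (Sym2 (Fin m)) → MvPolynomial (Fin (m + 1)) ℤ) :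
    PreChain (Fin (m + 1)) := Function.extend (starEdges k) F 0

variable {F : Finset (Sym2 (Fin m)) → MvPolynomial (Fin (m + 1)) ℤ}

theorem extendSucc_succEdges (s : Finset (Sym2 (Fin m))) : extendSucc F (succEdges s) = F s :=
  succEdges_injective.extend_apply _ _ _

theorem extendSucc_of_ne {t : Finset (Sym2 (Fin (m + 1)))} (h : ∀ s, t ≠ succEdges s) :
    extendSucc F t = 0 :=
  Function.extend_apply' _ _ _ fun ⟨s, hs⟩ => h s hs.symm

theorem extendStar_starEdges (k : Fin m) (s : Finset (Sym2 (Fin m))) :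
    extendStar k F (starEdges k s) = F s :=
  (starEdges_injective k).extend_apply _ _ _

theorem extendStar_of_ne {k : Fin m} {t : Finset (Sym2 (Fin (m + 1)))}
    (h : ∀ s, t ≠ starEdges k s) : extendStar k F t = 0 :=
  Function.extend_apply' _ _ _ fun ⟨s, hs⟩ => h s hs.symm

theorem extendSucc_mem_bidegreePart
    (hF : ∀ s, (F s ≠ 0 → (s.card : ℤ) = i) ∧ F s ∈ homogeneousPart (Fin (m + 1)) j) :
    extendSucc F ∈ bidegreePart (Fin (m + 1)) i j := by
  intro t
  by_cases ht : ∃ s, t = succEdges s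
  · obtain ⟨s, rfl⟩ := ht
    rw [extendSucc_succEdges, card_succEdges]
    exact hF s
  · rw [extendSucc_of_ne (not_exists.1 ht)]
    exact ⟨fun h => absurd rfl h, Submodule.zero_mem _⟩

theorem extendStar_mem_bidegreePart {k : Fin m}
    (hF : ∀ s, (F s ≠ 0 → (s.card : ℤ) = i - 1) ∧ F s ∈ homogeneousPart (Fin (m + 1)) j) :
    extendStar k F ∈ bidegreePart (Fin (m + 1)) i j := by
  intro t
  by_cases ht : ∃ s, t = starEdges k s
  · obtain ⟨s, rfl⟩ := ht
    rw [extendStar_starEdges, card_starEdges]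
    refine ⟨fun h => ?_, (hF s).2⟩
    have := (hF s).1 h
    push_cast
    omega
  · rw [extendStar_of_ne (not_exists.1 ht)]
    exact ⟨fun h => absurd rfl h, Submodule.zero_mem _⟩

theorem linearPart_extendStar (k : Fin m) : linearPart (extendStar k F) = 0 := by
  funext s
  rw [linearPart_apply, extendStar_of_ne fun t => (starEdges_ne_succEdges k t s).symm, map_zero,
    Polynomial.coeff_zero, Pi.zero_apply]

theorem starPart_extendSucc (k : Fin m) : starPart k (extendSucc F) = 0 := by
  funext s
  rw [starPart_apply, extendSucc_of_ne fun t => starEdges_ne_succEdges k s t, map_zero,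
    Pi.zero_apply]

theorem starPart_extendStar_of_ne {k l : Fin m} (h : k ≠ l) :
    starPart k (extendStar l F) = 0 := by
  funext s
  rw [starPart_apply, extendStar_of_ne fun t => starEdges_ne_starEdges h s t, map_zero,
    Pi.zero_apply]

theorem starPart_extendStar_rename (k : Fin m) (c : PreChain (Fin m)) :
    starPart k (extendStar k fun s => rename Fin.succ (c s)) = c := by
  funext s
  rw [starPart_apply, extendStar_starEdges, rename_mergeVertex_rename_succ]

theorem linearPart_extendSucc_X_mul (a : PreChain (Fin m)) :
    linearPart (extendSucc fun s => X 0 * rename Fin.succ (a s)) = a := by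
  funext s
  rw [linearPart_apply, extendSucc_succEdges, map_mul, finSuccEquiv_X_zero,
    finSuccEquiv_rename_succ, Polynomial.coeff_X_mul, Polynomial.coeff_C_zero]

theorem linearPart_extendSucc_rename (a : PreChain (Fin m)) :
    linearPart (extendSucc fun s => rename Fin.succ (a s)) = 0 := by
  funext s
  rw [linearPart_apply, extendSucc_succEdges, finSuccEquiv_rename_succ,
    Polynomial.coeff_C_of_ne_zero one_ne_zero, Pi.zero_apply]

end Restriction

/-! ### Differences of star parts and the connecting map -/

section DiffPart

variable {r : ℕ} {i j : ℤ}

/-- The difference of the parts of a family belonging to the edges from `0` to `k + 1` and to the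
first vertex of `K (r + 1)`. -/
def starDiff (k : Fin r) : PreChain (Fin (r + 1 + 1)) →ₗ[ℤ] PreChain (Fin (r + 1)) :=
  starPart k.succ - starPart 0

theorem starDiff_apply (k : Fin r) (f : PreChain (Fin (r + 1 + 1))) :
    starDiff k f = starPart k.succ f - starPart 0 f := rfl

theorem starDiff_mem_bidegreePart {f : PreChain (Fin (r + 1 + 1))}
    (hf : f ∈ bidegreePart _ i j) (k : Fin r) : starDiff k f ∈ bidegreePart _ (i - 1) j :=
  Submodule.sub_mem _ (starPart_mem_bidegreePart hf _) (starPart_mem_bidegreePart hf _)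

theorem starDiff_mem_nullChains {f : PreChain (Fin (r + 1 + 1))}
    (hf : f ∈ nullChains (K (r + 1 + 1))) (k : Fin r) : starDiff k f ∈ nullChains (K (r + 1)) :=
  Submodule.sub_mem _ (starPart_mem_nullChains hf _) (starPart_mem_nullChains hf _)

/-- The part of `f` of order zero in the removed variable enters all star parts equally and cancels
in the difference. Only the linear part remains, weighted by the difference of the two neighbours'
variables. -/
theorem starDiff_preDiff (k : Fin r) (f : PreChain (Fin (r + 1 + 1))) :
    starDiff k (preDiff f) - ((fun s => (X k.succ - X 0) * linearPart f s) -
      preDiff (starDiff k f)) ∈ nullChains (K (r + 1)) := by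
  intro s _
  have h1 := rename_mergeVertex_sub_mem k.succ s (f (succEdges s))
  have h2 := rename_mergeVertex_sub_mem 0 s (f (succEdges s))
  convert Ideal.sub_mem _ h1 h2 using 1
  simp only [starDiff_apply, map_sub, Pi.sub_apply, starPart_preDiff, linearPart_apply]
  ring

/-- The two kinds of parts can be prescribed independently: `a` as coefficient of `X 0`, each `c k`
in the star part of `k.succ`, and zero in the reference star part. -/
theorem exists_linearPart_starDiff {a : PreChain (Fin (r + 1))} {c : Fin r → PreChain (Fin (r + 1))}
    (ha : a ∈ bidegreePart _ i (j - 1)) (hc : ∀ k, c k ∈ bidegreePart _ (i - 1) j) :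
    ∃ f ∈ bidegreePart (Fin (r + 1 + 1)) i j, linearPart f = a ∧ ∀ k, starDiff k f = c k := by
  refine ⟨extendSucc (fun s => X 0 * rename Fin.succ (a s)) +
    ∑ k : Fin r, extendStar k.succ (fun s => rename Fin.succ (c k s)), ?_, ?_, ?_⟩
  · refine Submodule.add_mem _ (extendSucc_mem_bidegreePart fun s => ⟨fun h => ?_, ?_⟩)
      (Submodule.sum_mem _ fun k _ => extendStar_mem_bidegreePart fun s => ⟨fun h => ?_, ?_⟩)
    · exact (ha s).1 fun h0 => h (by rw [h0, map_zero, mul_zero])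
    · simpa using X_mul_mem_homogeneousPart (rename_mem_homogeneousPart (ha s).2 Fin.succ) 0
    · exact (hc k s).1 fun h0 => h (by rw [h0, map_zero])
    · exact rename_mem_homogeneousPart (hc k s).2 _
  · rw [map_add, linearPart_extendSucc_X_mul, map_sum]
    simp only [linearPart_extendStar, Finset.sum_const_zero, add_zero]
  · intro k
    rw [starDiff_apply, map_add, map_add, map_sum, map_sum, starPart_extendSucc,
      starPart_extendSucc, Finset.sum_eq_single k, starPart_extendStar_rename]
    · simp [starPart_extendStar_of_ne (Fin.succ_ne_zero _).symm]
    · intro l _ hl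
      exact starPart_extendStar_of_ne fun h => hl (Fin.succ_injective _ h).symm
    · simp

end DiffPart

/-! ### Acyclicity of the part with at least two edges at the first vertex -/

section Acyclic

variable {m : ℕ} {i j : ℤ}

/-- One step in removing, by a boundary, the part of a cycle with many edges at `0`. -/
theorem exists_preDiff_step {f : PreChain (Fin (m + 1))} (hf : f ∈ bidegreePart _ i j)
    (hd : preDiff f ∈ nullChains (K (m + 1))) {t : ℕ} (ht : 2 ≤ t)
    (hlow : ∀ s : Finset (Sym2 (Fin (m + 1))), (s : Set _) ⊆ (K (m + 1)).edgeSet →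
      (star s).card < t → f s ∈ relIdeal s) :
    ∃ y ∈ bidegreePart (Fin (m + 1)) (i - 1) j, (∀ s, (star s).card < 2 → y s = 0) ∧
      ∀ s : Finset (Sym2 (Fin (m + 1))), (s : Set _) ⊆ (K (m + 1)).edgeSet →
      (star s).card < t + 1 → (f - preDiff y) s ∈ relIdeal s := by
  -- The chord is chosen from the star alone, so edge sets with the same star are contracted along
  -- the same chord.
  let P (T : Finset (Sym2 (Fin (m + 1)))) (e : Sym2 (Fin (m + 1))) : Prop :=
    ∃ k l : Fin m, k ≠ l ∧ s(0, k.succ) ∈ T ∧ s(0, l.succ) ∈ T ∧ e = s(k.succ, l.succ)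
  have hP : ∀ T, ∃ e, (∃ e', P T e') → P T e := by
    intro T
    by_cases h : ∃ e', P T e'
    · exact ⟨h.choose, fun _ => h.choose_spec⟩
    · exact ⟨s(0, 0), fun h' => absurd h' h⟩
  choose c hc using hP
  refine ⟨fun s => if (star s).card = t then contraction (c (star s)) f s else 0, ?_, ?_, ?_⟩
  · intro s
    dsimp only
    split_ifs
    · exact contraction_mem_bidegreePart hf _ s
    · exact ⟨fun h => absurd rfl h, Submodule.zero_mem _⟩
  · intro s hs
    exact if_neg (by omega)
  · intro s hs hst
    rcases Nat.lt_succ_iff_lt_or_eq.1 hst with hlt | heq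
    · rw [Pi.sub_apply, preDiff_apply, Finset.sum_eq_zero, sub_zero]
      · exact hlow s hs hlt
      · intro e he
        have : (star (s.erase e)).card ≤ (star s).card :=
          Finset.card_le_card (Finset.filter_subset_filter _ (Finset.erase_subset _ _))
        rw [if_neg (by omega), smul_zero]
    · obtain ⟨k, l, hkl, hk, hl⟩ := exists_two_star_edges hs (by omega)
      obtain ⟨k, l, hkl, hk, hl, hkl'⟩ := hc (star s) ⟨_, k, l, hkl, hk, hl, rfl⟩
      set e₀ := c (star s) with he₀
      have hk' := (Finset.mem_filter.1 hk).1
      have hl' := (Finset.mem_filter.1 hl).1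
      have h0 : 0 ∉ e₀ := by
        rw [hkl']
        simp [(Fin.succ_ne_zero _).symm]
      have hdiag : ¬ e₀.IsDiag := by
        rw [hkl']
        simpa using hkl
      -- The ends of the chord are already connected through `0`.
      have hins : relIdeal (insert e₀ s) = relIdeal s := by
        rw [hkl']
        refine relIdeal_insert_of_mem ?_
        simpa using Ideal.sub_mem _ (X_sub_X_mem_relIdeal hl') (X_sub_X_mem_relIdeal hk')
      have hinsE : ((insert e₀ s : Finset _) : Set (Sym2 (Fin (m + 1)))) ⊆ (K (m + 1)).edgeSet := by
        rw [subset_edgeSet_K] at hs ⊢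
        intro e he
        rcases Finset.mem_insert.1 he with rfl | he
        exacts [hdiag, hs e he]
      have h1 : contraction e₀ (preDiff f) s ∈ relIdeal s := by
        by_cases hmem : e₀ ∈ s
        · rw [contraction_of_mem hmem]
          exact Ideal.zero_mem _
        · rw [contraction_of_notMem hmem]
          refine zsmul_mem_relIdeal _ ?_
          rw [← hins]
          exact hd _ hinsE
      have h2 : preDiff (contraction e₀ f) s - preDiff (fun s => if (star s).card = t then
          contraction (c (star s)) f s else 0) s ∈ relIdeal s := by
        rw [preDiff_apply, preDiff_apply, ← Finset.sum_sub_distrib]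
        refine Ideal.sum_mem _ fun e he => ?_
        rw [← smul_sub]
        refine zsmul_mem_relIdeal _ ?_
        -- Removing an edge at `0` drops the star below `t`: the primitive is zero there, and the
        -- full contraction is negligible by `hlow`, since the chord leaves the star unchanged.
        -- Otherwise the star, hence the chord, is the same and the two terms agree.
        by_cases h0e : 0 ∈ e
        · have hcard := card_star_erase_lt h0e he
          rw [if_neg (by omega), sub_zero]
          by_cases hmem : e₀ ∈ s.erase e
          · rw [contraction_of_mem hmem]
            exact Ideal.zero_mem _
          · rw [contraction_of_notMem hmem]
            refine zsmul_mem_relIdeal _ ?_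
            rw [← hins]
            have hsub : insert e₀ (s.erase e) ⊆ insert e₀ s :=
              Finset.insert_subset_insert _ (Finset.erase_subset _ _)
            refine relIdeal_mono hsub (hlow _ ((Finset.coe_subset.2 hsub).trans hinsE) ?_)
            rw [star_insert_of_notMem h0]
            omega
        · rw [star_erase_of_notMem h0e, if_pos heq, ← he₀, sub_self]
          exact Ideal.zero_mem _
      have h3 := congrFun (preDiff_contraction_add e₀ f) s
      rw [Pi.add_apply] at h3
      rw [Pi.sub_apply, ← h3]
      convert Ideal.add_mem _ h1 h2 using 1
      abel

/-- A cycle without a part having fewer than two edges at `0` is a boundary. -/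
theorem exists_preDiff_of_star {f : PreChain (Fin (m + 1))} (hf : f ∈ bidegreePart _ i j)
    (hd : preDiff f ∈ nullChains (K (m + 1)))
    (hlow : ∀ s : Finset (Sym2 (Fin (m + 1))), (s : Set _) ⊆ (K (m + 1)).edgeSet →
      (star s).card < 2 → f s ∈ relIdeal s) :
    ∃ y ∈ bidegreePart (Fin (m + 1)) (i - 1) j, (∀ s, (star s).card < 2 → y s = 0) ∧
      f - preDiff y ∈ nullChains (K (m + 1)) := by
  have key : ∀ t, 2 ≤ t → ∃ y ∈ bidegreePart (Fin (m + 1)) (i - 1) j,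
      (∀ s, (star s).card < 2 → y s = 0) ∧
      ∀ s : Finset (Sym2 (Fin (m + 1))), (s : Set _) ⊆ (K (m + 1)).edgeSet →
      (star s).card < t → (f - preDiff y) s ∈ relIdeal s := by
    intro t ht
    induction t, ht using Nat.le_induction with
    | base => exact ⟨0, Submodule.zero_mem _, fun _ _ => rfl, by simpa using hlow⟩
    | succ t ht ih =>
      obtain ⟨y, hy, hy0, hyt⟩ := ih
      have hdy : preDiff y ∈ bidegreePart (Fin (m + 1)) i j := by
        simpa using preDiff_mem_bidegreePart hy
      obtain ⟨y', hy', hy0', hyt'⟩ := exists_preDiff_step (Submodule.sub_mem _ hf hdy)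
        (by rwa [map_sub, preDiff_preDiff, sub_zero]) ht hyt
      refine ⟨y + y', Submodule.add_mem _ hy hy', fun s hs => ?_, fun s hs hst => ?_⟩
      · rw [Pi.add_apply, hy0 s hs, hy0' s hs, add_zero]
      · rw [map_add, ← sub_sub]
        exact hyt' s hs hst
  -- This bound exceeds the size of every star; the added `2` also secures the starting condition of
  -- the induction.
  obtain ⟨y, hy, hy0, h⟩ := key (Fintype.card (Sym2 (Fin (m + 1))) + 2) (by omega)
  refine ⟨y, hy, hy0, fun s hs => h s hs ?_⟩
  have := Finset.card_le_univ (star s)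
  omega

end Acyclic

/-! ### Cycles whose surviving parts are trivial -/

section Kernel

variable {r : ℕ} {i j : ℤ}

/-- A cycle of `K (r + 2)` with trivial `linearPart` and `starDiff` is a boundary. -/
theorem exists_preDiff_of_parts {f : PreChain (Fin (r + 1 + 1))} (hf : f ∈ bidegreePart _ i j)
    (hd : preDiff f ∈ nullChains (K (r + 1 + 1)))
    (hlin : linearPart f ∈ nullChains (K (r + 1)))
    (hstar : ∀ k, starDiff k f ∈ nullChains (K (r + 1))) :
    ∃ y ∈ bidegreePart (Fin (r + 1 + 1)) (i - 1) j, linearPart y = 0 ∧ (∀ k, starDiff k y = 0) ∧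
      f - preDiff y ∈ nullChains (K (r + 1 + 1)) := by
  set v := starPart 0 f with hv
  have hvdeg : v ∈ bidegreePart _ (i - 1) j := starPart_mem_bidegreePart hf 0
  -- Placed on edge sets avoiding `0` and free of `X 0`, `v` has a differential equal to `v` in
  -- every star part. As all star parts of `f` agree with `v` modulo relations, this removes them
  -- simultaneously.
  set y₁ : PreChain (Fin (r + 1 + 1)) := extendSucc fun s => rename Fin.succ (v s) with hy₁
  have hy₁deg : y₁ ∈ bidegreePart _ (i - 1) j := extendSucc_mem_bidegreePart fun s =>
    ⟨fun h => (hvdeg s).1 fun h0 => h (by rw [h0, map_zero]),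
      rename_mem_homogeneousPart (hvdeg s).2 _⟩
  have hlin₁ : linearPart y₁ = 0 := linearPart_extendSucc_rename v
  have hstar₁ : ∀ k, starDiff k y₁ = 0 := fun k => by
    rw [starDiff_apply, starPart_extendSucc, starPart_extendSucc, sub_zero]
  have hallstar : ∀ k, starPart k f - v ∈ nullChains (K (r + 1)) := by
    intro k
    cases k using Fin.cases with
    | zero => rw [hv, sub_self]; exact Submodule.zero_mem _
    | succ k => exact hstar k
  have hsucc : ∀ s : Finset (Sym2 (Fin (r + 1))), preDiff y₁ (succEdges s) =
      rename Fin.succ (preDiff v s) := by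
    intro s
    rw [preDiff_succEdges, preDiff_apply, map_sum]
    refine Finset.sum_congr rfl fun e _ => ?_
    rw [hy₁, extendSucc_succEdges, map_zsmul]
  have hlow : ∀ s : Finset (Sym2 (Fin (r + 1 + 1))), (s : Set _) ⊆ (K (r + 1 + 1)).edgeSet →
      (star s).card < 2 → (f - preDiff y₁) s ∈ relIdeal s := by
    intro s hs hs2
    have hs01 : (star s).card = 0 ∨ (star s).card = 1 := by omega
    rcases hs01 with hs0 | hs1
    · obtain ⟨s, rfl⟩ := exists_succEdges_of_star_eq_empty (Finset.card_eq_zero.1 hs0)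
      have hs' := succEdges_subset_iff.1 hs
      have hl := hlin s hs'
      rw [linearPart_apply] at hl
      rw [Pi.sub_apply, hsucc, mem_relIdeal_succEdges_iff, map_sub, finSuccEquiv_rename_succ,
        Polynomial.coeff_sub, Polynomial.coeff_sub, Polynomial.coeff_C_zero,
        Polynomial.coeff_C_of_ne_zero one_ne_zero, sub_zero]
      refine ⟨?_, hl⟩
      -- The cycle condition in the reference star part forces the order-zero coefficient of `f` to
      -- be `preDiff v` modulo relations, as the linear coefficient is negligible.
      have h1 := starPart_mem_nullChains hd 0 s hs'
      rw [starPart_preDiff] at h1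
      have h2 := rename_mergeVertex_sub_mem 0 s (f (succEdges s))
      convert Ideal.sub_mem _ (Ideal.sub_mem _ h1 h2) (Ideal.mul_mem_left _ (X 0) hl) using 1
      ring
    · obtain ⟨k, s, rfl⟩ := exists_starEdges_of_card_star_eq_one hs hs1
      rw [mem_relIdeal_starEdges_iff, ← starPart_apply, map_sub, Pi.sub_apply, starPart_preDiff,
        starPart_extendSucc, map_zero, Pi.zero_apply, sub_zero, hy₁, extendSucc_succEdges,
        rename_mergeVertex_rename_succ]
      exact hallstar k s (starEdges_subset_iff.1 hs)
  have hdy₁ : preDiff y₁ ∈ bidegreePart (Fin (r + 1 + 1)) i j := by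
    simpa using preDiff_mem_bidegreePart hy₁deg
  obtain ⟨y₂, hy₂, hy₂0, h⟩ := exists_preDiff_of_star (Submodule.sub_mem _ hf hdy₁)
    (by rwa [map_sub, preDiff_preDiff, sub_zero]) hlow
  have hlin₂ : linearPart y₂ = 0 := by
    funext s
    rw [linearPart_apply, hy₂0 _ (by simp [star_succEdges]), map_zero, Polynomial.coeff_zero,
      Pi.zero_apply]
  have hstar₂ : ∀ k, starPart k y₂ = 0 := by
    intro k
    funext s
    rw [starPart_apply, hy₂0 _ (by simp [card_star_starEdges]), map_zero, Pi.zero_apply]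
  refine ⟨y₁ + y₂, Submodule.add_mem _ hy₁deg hy₂, ?_, fun k => ?_, ?_⟩
  · rw [map_add, hlin₁, hlin₂, add_zero]
  · rw [map_add, hstar₁, starDiff_apply, hstar₂, hstar₂, sub_zero, add_zero]
  · rwa [map_add, ← sub_sub]

end Kernel

/-! ### Homotopies between multiplications by variables -/

section Homotopy

variable {V : Type} [LinearOrder V] {i j : ℤ}

/-- For an edge `{a, b}`, the homotopy killing the multiplication by `X a + X b`. -/
def edgeHomotopy (a b : V) : PreChain V →ₗ[ℤ] PreChain V where
  toFun f s := (X a + X b) * contraction s(a, b) f s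
  map_add' f g := by
    funext s
    simp only [map_add, Pi.add_apply, mul_add]
  map_smul' c f := by
    funext s
    simp only [map_smul, Pi.smul_apply, mul_smul_comm, RingHom.id_apply]

theorem edgeHomotopy_apply (a b : V) (f : PreChain V) (s : Finset (Sym2 V)) :
    edgeHomotopy a b f s = (X a + X b) * contraction s(a, b) f s := rfl

/-- Multiplication by a fixed polynomial commutes with `preDiff`, so this is the contraction
identity times `X a + X b`. -/
theorem preDiff_edgeHomotopy_add (a b : V) (f : PreChain V) (s : Finset (Sym2 V)) :
    preDiff (edgeHomotopy a b f) s + edgeHomotopy a b (preDiff f) s = (X a + X b) * f s := by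
  have h := congrFun (preDiff_contraction_add s(a, b) f) s
  rw [Pi.add_apply] at h
  conv_rhs => rw [← h]
  rw [mul_add, edgeHomotopy_apply, preDiff_apply, preDiff_apply, Finset.mul_sum]
  simp only [edgeHomotopy_apply, mul_smul_comm]

theorem edgeHomotopy_mem_bidegreePart {f : PreChain V} (hf : f ∈ bidegreePart V i j) (a b : V) :
    edgeHomotopy a b f ∈ bidegreePart V (i - 1) (j + 1) := by
  have h := contraction_mem_bidegreePart hf s(a, b)
  intro s
  refine ⟨fun h' => (h s).1 (right_ne_zero_of_mul h'), ?_⟩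
  rw [edgeHomotopy_apply, add_mul]
  exact Submodule.add_mem _ (X_mul_mem_homogeneousPart (h s).2 a)
    (X_mul_mem_homogeneousPart (h s).2 b)

theorem edgeHomotopy_mem_nullChains {G : SimpleGraph V} {a b : V} (hab : G.Adj a b)
    {f : PreChain V} (hf : f ∈ nullChains G) : edgeHomotopy a b f ∈ nullChains G := by
  intro s hs
  rw [edgeHomotopy_apply]
  by_cases hmem : s(a, b) ∈ s
  · rw [contraction_of_mem hmem, mul_zero]
    exact Ideal.zero_mem _
  · rw [contraction_of_notMem hmem, mul_smul_comm]
    refine zsmul_mem_relIdeal _ (X_add_X_mul_mem_relIdeal (hf _ ?_))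
    rw [Finset.coe_insert]
    exact Set.insert_subset hab hs

/-- For adjacent pairs `{a, l}` and `{l, b}`, the homotopy killing the multiplication by
`X a - X b`. -/
def pathHomotopy (a l b : V) : PreChain V →ₗ[ℤ] PreChain V := edgeHomotopy a l - edgeHomotopy l b

theorem preDiff_pathHomotopy_add (a l b : V) (f : PreChain V) :
    preDiff (pathHomotopy a l b f) + pathHomotopy a l b (preDiff f) =
      fun s => (X a - X b) * f s := by
  funext s
  have h1 := preDiff_edgeHomotopy_add a l f s
  have h2 := preDiff_edgeHomotopy_add l b f s
  simp only [pathHomotopy, LinearMap.sub_apply, map_sub, Pi.add_apply, Pi.sub_apply]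
  linear_combination h1 - h2

theorem pathHomotopy_mem_bidegreePart {f : PreChain V} (hf : f ∈ bidegreePart V i j) (a l b : V) :
    pathHomotopy a l b f ∈ bidegreePart V (i - 1) (j + 1) :=
  Submodule.sub_mem _ (edgeHomotopy_mem_bidegreePart hf _ _) (edgeHomotopy_mem_bidegreePart hf _ _)

theorem pathHomotopy_mem_nullChains {G : SimpleGraph V} {a l b : V} (hal : G.Adj a l)
    (hlb : G.Adj l b) {f : PreChain V} (hf : f ∈ nullChains G) :
    pathHomotopy a l b f ∈ nullChains G :=
  Submodule.sub_mem _ (edgeHomotopy_mem_nullChains hal hf) (edgeHomotopy_mem_nullChains hlb hf)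

end Homotopy

/-! ### The recursion -/

section Recursion

variable {r : ℕ} {i j : ℤ}

/-- `starDiff`, corrected so as to anticommute with the differential. -/
def starChainMap (l : Fin r → Fin (r + 1)) (k : Fin r) :
    PreChain (Fin (r + 1 + 1)) →ₗ[ℤ] PreChain (Fin (r + 1)) :=
  starDiff k - pathHomotopy k.succ (l k) 0 ∘ₗ linearPart

variable {l : Fin r → Fin (r + 1)}

theorem starChainMap_apply (k : Fin r) (f : PreChain (Fin (r + 1 + 1))) :
    starChainMap l k f = starDiff k f - pathHomotopy k.succ (l k) 0 (linearPart f) := rfl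

theorem starChainMap_mem_bidegreePart {f : PreChain (Fin (r + 1 + 1))}
    (hf : f ∈ bidegreePart _ i j) (k : Fin r) :
    starChainMap l k f ∈ bidegreePart _ (i - 1) j := by
  refine Submodule.sub_mem _ (starDiff_mem_bidegreePart hf k) ?_
  have := pathHomotopy_mem_bidegreePart (linearPart_mem_bidegreePart hf) k.succ (l k) 0
  rwa [sub_add_cancel] at this

theorem starChainMap_mem_nullChains (hl : ∀ k, k.succ ≠ l k) (hl0 : ∀ k, l k ≠ 0)
    {f : PreChain (Fin (r + 1 + 1))} (hf : f ∈ nullChains (K (r + 1 + 1))) (k : Fin r) :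
    starChainMap l k f ∈ nullChains (K (r + 1)) :=
  Submodule.sub_mem _ (starDiff_mem_nullChains hf k)
    (pathHomotopy_mem_nullChains (hl k) (hl0 k) (linearPart_mem_nullChains hf))

/-- The homotopy formula for `X k.succ - X 0` absorbs exactly the connecting term in
`starDiff_preDiff`. -/
theorem starChainMap_preDiff (k : Fin r) (f : PreChain (Fin (r + 1 + 1))) :
    starChainMap l k (preDiff f) + preDiff (starChainMap l k f) ∈ nullChains (K (r + 1)) := by
  have h1 := starDiff_preDiff k f
  have h2 := preDiff_pathHomotopy_add k.succ (l k) 0 (linearPart f)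
  rw [← h2] at h1
  rw [starChainMap_apply, starChainMap_apply, linearPart_preDiff, map_sub]
  convert h1 using 1
  abel

theorem starDiff_mem_of_starChainMap_mem (hl : ∀ k, k.succ ≠ l k) (hl0 : ∀ k, l k ≠ 0)
    {f : PreChain (Fin (r + 1 + 1))} (hlin : linearPart f ∈ nullChains (K (r + 1))) {k : Fin r}
    (hk : starChainMap l k f ∈ nullChains (K (r + 1))) : starDiff k f ∈ nullChains (K (r + 1)) := by
  have := Submodule.add_mem _ hk (pathHomotopy_mem_nullChains (hl k) (hl0 k) hlin)
  rwa [starChainMap_apply, sub_add_cancel] at this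

theorem exists_linearPart_starChainMap {a : PreChain (Fin (r + 1))}
    {c : Fin r → PreChain (Fin (r + 1))} (ha : a ∈ bidegreePart _ i (j - 1))
    (hc : ∀ k, c k ∈ bidegreePart _ (i - 1) j) :
    ∃ f ∈ bidegreePart (Fin (r + 1 + 1)) i j, linearPart f = a ∧
      ∀ k, starChainMap l k f = c k := by
  obtain ⟨f, hf, hfa, hfc⟩ := exists_linearPart_starDiff (i := i) (j := j)
    (c := fun k => c k + pathHomotopy k.succ (l k) 0 a) ha fun k => Submodule.add_mem _ (hc k) (by
      have := pathHomotopy_mem_bidegreePart ha k.succ (l k) 0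
      rwa [sub_add_cancel] at this)
  exact ⟨f, hf, hfa, fun k => by rw [starChainMap_apply, hfc, hfa, add_sub_cancel_right]⟩

theorem linearPart_mem_modelCycles {f : PreChain (Fin (r + 1 + 1))}
    (hf : f ∈ modelCycles (K (r + 1 + 1)) i j) :
    linearPart f ∈ modelCycles (K (r + 1)) i (j - 1) := by
  refine mem_modelCycles.2 ⟨linearPart_mem_bidegreePart hf.1, ?_⟩
  rw [← linearPart_preDiff]
  exact linearPart_mem_nullChains hf.2

theorem starChainMap_mem_modelCycles (hl : ∀ k, k.succ ≠ l k) (hl0 : ∀ k, l k ≠ 0)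
    {f : PreChain (Fin (r + 1 + 1))} (hf : f ∈ modelCycles (K (r + 1 + 1)) i j) (k : Fin r) :
    starChainMap l k f ∈ modelCycles (K (r + 1)) (i - 1) j := by
  refine ⟨starChainMap_mem_bidegreePart hf.1 k, ?_⟩
  have h1 := starChainMap_preDiff (l := l) k f
  have h2 := starChainMap_mem_nullChains hl hl0 hf.2 k
  simpa using Submodule.sub_mem _ h1 h2

/-- The recursion for the homology of the polynomial model of a complete graph. -/
theorem nonempty_modelHomology_equiv (hr : 2 ≤ r) (i j : ℤ) :
    Nonempty (ModelHomology (K (r + 1 + 1)) i j ≃ₗ[ℤ]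
      (Fin r → ModelHomology (K (r + 1)) (i - 1) j) × ModelHomology (K (r + 1)) i (j - 1)) := by
  -- The intermediate vertex of the path from `k.succ` to `0`; this is where `2 ≤ r` is needed.
  have hex : ∀ k : Fin r, ∃ l : Fin (r + 1), k.succ ≠ l ∧ l ≠ 0 := by
    intro k
    have : Nontrivial (Fin r) := Fin.nontrivial_iff_two_le.2 hr
    obtain ⟨l, hl⟩ := exists_ne k
    exact ⟨l.succ, fun h => hl (Fin.succ_injective _ h).symm, Fin.succ_ne_zero l⟩
  choose l hl hl0 using hex
  refine ⟨subquotientEquiv _ _ (LinearMap.prod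
    (LinearMap.pi fun k => Submodule.mkQ _ ∘ₗ (starChainMap l k).restrict
      fun f hf => starChainMap_mem_modelCycles hl hl0 hf k)
    (Submodule.mkQ _ ∘ₗ linearPart.restrict fun f hf => linearPart_mem_modelCycles hf)) ?_ ?_⟩
  · rintro ⟨c, a⟩
    obtain ⟨a, rfl⟩ := Submodule.mkQ_surjective _ a
    choose c' hc' using fun k => Submodule.mkQ_surjective _ (c k)
    obtain rfl : (fun k => Submodule.mkQ _ (c' k)) = c := funext hc'
    obtain ⟨f, hf, hfa, hfc⟩ := exists_linearPart_starChainMap (l := l) a.2.1 fun k => (c' k).2.1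
    have hlin : linearPart (preDiff f) ∈ nullChains (K (r + 1)) := by
      rw [linearPart_preDiff, hfa]
      exact a.2.2
    have hstar : ∀ k, starChainMap l k (preDiff f) ∈ nullChains (K (r + 1)) := by
      intro k
      have := Submodule.sub_mem _ (starChainMap_preDiff (l := l) k f)
        (show preDiff (starChainMap l k f) ∈ nullChains (K (r + 1)) by
          rw [hfc]; exact (c' k).2.2)
      rwa [add_sub_cancel_right] at this
    -- The lift `f` need not be a cycle, but `preDiff f` has trivial parts and so is the boundary of
    -- some `y` modulo relations. Since the parts of `y` vanish exactly, `f - y` is a cycle with the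
    -- prescribed parts.
    obtain ⟨y, hy, hy1, hy2, hfy⟩ := exists_preDiff_of_parts (preDiff_mem_bidegreePart hf)
      (by rw [preDiff_preDiff]; exact Submodule.zero_mem _) hlin
      fun k => starDiff_mem_of_starChainMap_mem hl hl0 hlin (hstar k)
    rw [add_sub_cancel_right] at hy
    refine ⟨⟨f - y, mem_modelCycles.2 ⟨Submodule.sub_mem _ hf hy, by rwa [map_sub]⟩⟩, ?_⟩
    refine Prod.ext (funext fun k => congrArg (Submodule.mkQ _) (Subtype.ext ?_))
      (congrArg (Submodule.mkQ _) (Subtype.ext ?_))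
    · show starChainMap l k (f - y) = c' k
      rw [map_sub, hfc, starChainMap_apply, hy1, hy2, map_zero, sub_zero, sub_zero]
    · show linearPart (f - y) = a
      rw [map_sub, hfa, hy1, sub_zero]
  · rintro ⟨f, hf⟩
    have hzero : (LinearMap.prod
        (LinearMap.pi fun k => Submodule.mkQ _ ∘ₗ (starChainMap l k).restrict
          fun f hf => starChainMap_mem_modelCycles hl hl0 hf k)
        (Submodule.mkQ _ ∘ₗ linearPart.restrict fun f hf => linearPart_mem_modelCycles hf)
          : modelCycles (K (r + 1 + 1)) i j →ₗ[ℤ] (Fin r → ModelHomology (K (r + 1)) (i - 1) j) ×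
            ModelHomology (K (r + 1)) i (j - 1)) ⟨f, hf⟩ = 0 ↔
        (∀ k, starChainMap l k f ∈ modelBoundaries (K (r + 1)) (i - 1) j) ∧
          linearPart f ∈ modelBoundaries (K (r + 1)) i (j - 1) := by
      rw [Prod.ext_iff]
      refine and_congr ?_ (Submodule.Quotient.mk_eq_zero _)
      rw [_root_.funext_iff]
      exact forall_congr' fun k => Submodule.Quotient.mk_eq_zero _
    rw [hzero]
    simp only [mem_modelBoundaries]
    constructor
    · rintro ⟨hc, a', ha', haf⟩
      choose c' hc' hcf using hc
      obtain ⟨g, hg, hga, hgc⟩ := exists_linearPart_starChainMap (l := l) (i := i - 1) (j := j)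
        -- The sign compensates for `starChainMap` anticommuting with the differential.
        (c := fun k => -c' k) ha' fun k => Submodule.neg_mem _ (hc' k)
      have hdg : preDiff g ∈ bidegreePart (Fin (r + 1 + 1)) i j := by
        simpa using preDiff_mem_bidegreePart hg
      have hlin : linearPart (f - preDiff g) ∈ nullChains (K (r + 1)) := by
        rwa [map_sub, linearPart_preDiff, hga]
      have hstar : ∀ k, starChainMap l k (f - preDiff g) ∈ nullChains (K (r + 1)) := by
        intro k
        have h1 := starChainMap_preDiff (l := l) k g
        rw [hgc, map_neg] at h1
        convert Submodule.sub_mem _ (hcf k) h1 using 1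
        rw [map_sub]
        abel
      obtain ⟨y, hy, _, _, hfy⟩ := exists_preDiff_of_parts (Submodule.sub_mem _ hf.1 hdg)
        (by rw [map_sub, preDiff_preDiff, sub_zero]; exact hf.2) hlin
        fun k => starDiff_mem_of_starChainMap_mem hl hl0 hlin (hstar k)
      exact ⟨g + y, Submodule.add_mem _ hg hy, by rwa [map_add, ← sub_sub]⟩
    · rintro ⟨y, hy, hfy⟩
      refine ⟨fun k => ⟨-starChainMap l k y,
        Submodule.neg_mem _ (starChainMap_mem_bidegreePart hy k), ?_⟩,
        linearPart y, linearPart_mem_bidegreePart hy, ?_⟩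
      · have h1 := starChainMap_mem_nullChains hl hl0 hfy k
        have h2 := starChainMap_preDiff (l := l) k y
        convert Submodule.add_mem _ h1 h2 using 1
        rw [map_sub, map_neg]
        abel
      · have h1 := linearPart_mem_nullChains hfy
        rwa [map_sub, linearPart_preDiff] at h1

end Recursion

/-! ### Vanishing in high degrees -/

section Vanishing

variable {r : ℕ} {i j : ℤ}

/-- If both outer terms vanish, no splitting is required, so small `r` is allowed. The `Fin r`
argument of `h2` makes that hypothesis vacuous for `r = 0`, where no star differences exist. -/
theorem modelCycles_le_of_le
    (h1 : ∀ j, modelCycles (K (r + 1)) i j ≤ modelBoundaries (K (r + 1)) i j)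
    (h2 : ∀ (_ : Fin r) j,
      modelCycles (K (r + 1)) (i - 1) j ≤ modelBoundaries (K (r + 1)) (i - 1) j) :
    modelCycles (K (r + 1 + 1)) i j ≤ modelBoundaries (K (r + 1 + 1)) i j := by
  intro f hf
  rw [mem_modelBoundaries]
  obtain ⟨a', ha', haf⟩ := mem_modelBoundaries.1 (h1 _ (linearPart_mem_modelCycles hf))
  obtain ⟨g, hg, hga, -⟩ := exists_linearPart_starDiff (i := i - 1) (j := j) (c := 0) ha'
    fun k => Submodule.zero_mem _
  have hdg : preDiff g ∈ bidegreePart (Fin (r + 1 + 1)) i j := by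
    simpa using preDiff_mem_bidegreePart hg
  have hfg : f - preDiff g ∈ bidegreePart _ i j := Submodule.sub_mem _ hf.1 hdg
  have hdfg : preDiff (f - preDiff g) ∈ nullChains (K (r + 1 + 1)) := by
    rw [map_sub, preDiff_preDiff, sub_zero]
    exact hf.2
  have hlin : linearPart (f - preDiff g) ∈ nullChains (K (r + 1)) := by
    rwa [map_sub, linearPart_preDiff, hga]
  -- Once the linear part is negligible the connecting term is too, so the uncorrected differences
  -- are already cycles.
  have hcyc : ∀ k, starDiff k (f - preDiff g) ∈ modelCycles (K (r + 1)) (i - 1) j := by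
    intro k
    refine mem_modelCycles.2 ⟨starDiff_mem_bidegreePart hfg k, ?_⟩
    have h3 := starDiff_preDiff k (f - preDiff g)
    have h4 := starDiff_mem_nullChains hdfg k
    have h5 : (fun s => (X k.succ - X 0) * linearPart (f - preDiff g) s) ∈
        nullChains (K (r + 1)) := fun s hs => Ideal.mul_mem_left _ _ (hlin s hs)
    convert Submodule.add_mem _ (Submodule.sub_mem _ h3 h4) h5 using 1
    abel
  choose c' hc' hcf using fun k => mem_modelBoundaries.1 (h2 k _ (hcyc k))
  obtain ⟨g', hg', hga', hgc'⟩ := exists_linearPart_starDiff (i := i - 1) (j := j)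
    (c := fun k => -c' k) (Submodule.zero_mem _) fun k => Submodule.neg_mem _ (hc' k)
  have hdg' : preDiff g' ∈ bidegreePart (Fin (r + 1 + 1)) i j := by
    simpa using preDiff_mem_bidegreePart hg'
  obtain ⟨y, hy, -, -, hfy⟩ := exists_preDiff_of_parts (Submodule.sub_mem _ hfg hdg')
    (by rwa [map_sub, preDiff_preDiff, sub_zero])
    (by rwa [map_sub, linearPart_preDiff, hga', map_zero, sub_zero])
    (by
      intro k
      have h3 := starDiff_preDiff k g'
      have h5 : (fun s => (X k.succ - X 0) * linearPart g' s) = 0 := by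
        funext s
        rw [hga', Pi.zero_apply, mul_zero]
      rw [h5, hgc', map_neg, zero_sub, neg_neg] at h3
      convert Submodule.sub_mem _ (hcf k) h3 using 1
      rw [map_sub _ (f - preDiff g)]
      abel)
  exact ⟨g + g' + y, Submodule.add_mem _ (Submodule.add_mem _ hg hg') hy, by
    rwa [map_add, map_add, ← sub_sub, ← sub_sub]⟩

theorem modelCycles_K_one_le (hi : 1 ≤ i) : modelCycles (K 1) i j ≤ modelBoundaries (K 1) i j := by
  intro f hf
  refine mem_modelBoundaries.2 ⟨0, Submodule.zero_mem _, fun s hs => ?_⟩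
  have hs0 : s = ∅ := by
    refine Finset.eq_empty_of_forall_notMem fun e he => subset_edgeSet_K.1 hs e he ?_
    induction e with | h a b => exact Subsingleton.elim a b
  rw [map_zero, sub_zero]
  by_cases h : f s = 0
  · rw [h]
    exact Ideal.zero_mem _
  · have := (hf.1 s).1 h
    simp [hs0] at this
    omega

/-- The homology of the complete graph on `r + 2` vertices vanishes in degrees above `r`. -/
theorem modelCycles_le_modelBoundaries (r : ℕ) : ∀ {i j : ℤ}, (r : ℤ) + 1 ≤ i →
    modelCycles (K (r + 1 + 1)) i j ≤ modelBoundaries (K (r + 1 + 1)) i j := by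
  induction r with
  | zero =>
    intro i j hi
    exact modelCycles_le_of_le (fun j => modelCycles_K_one_le (by simpa using hi))
      fun k => k.elim0
  | succ r ih =>
    intro i j hi
    push_cast at hi
    exact modelCycles_le_of_le (fun j => ih (by omega)) fun _ j => ih (by omega)

end Vanishing

/-! ### Degree zero -/

section DegreeZero

variable {V : Type} [LinearOrder V]

/-- Every monomial in a multiple of `X a - X b` involves `X a` or `X b`. -/
theorem coeff_eq_zero_of_mem_relIdeal {a b : V} {Y : Finset V} (ha : a ∉ Y) (hb : b ∉ Y)
    {p : MvPolynomial V ℤ} (hp : p ∈ relIdeal {s(a, b)}) : coeff (sqfreeExp Y) p = 0 := by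
  have hX : ∀ (q : MvPolynomial V ℤ) (c : V), c ∉ Y → coeff (sqfreeExp Y) (q * X c) = 0 := by
    intro q c hc
    rw [coeff_mul_X', if_neg]
    simp [sqfreeExp_apply, hc]
  refine map_eq_zero_of_mem_relIdeal (lcoeff ℤ (sqfreeExp Y))
    (fun q v => coeff_sqfreeExp_mul_X_sq Y q v) (fun q c d hcd => ?_) hp
  rw [lcoeff_apply, mul_sub, coeff_sub]
  rcases Sym2.eq_iff.1 (Finset.mem_singleton.1 hcd) with ⟨rfl, rfl⟩ | ⟨rfl, rfl⟩ <;>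
    simp [hX, ha, hb]

/-- A multiple `q * (X a - X b)` contributes the coefficient of `Y` in `q` to the two terms with
opposite signs. -/
theorem coeff_insert_add_eq_zero {a b : V} {Y : Finset V} (hab : a ≠ b) (ha : a ∉ Y) (hb : b ∉ Y)
    {p : MvPolynomial V ℤ} (hp : p ∈ relIdeal {s(a, b)}) :
    coeff (sqfreeExp (insert a Y)) p + coeff (sqfreeExp (insert b Y)) p = 0 := by
  have hX : ∀ (q : MvPolynomial V ℤ) (c d : V), c ∉ Y → c ≠ d →
      coeff (sqfreeExp (insert d Y)) (q * X c) = 0 := by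
    intro q c d hc hcd
    rw [coeff_mul_X', if_neg]
    simp [sqfreeExp_apply, hc, hcd]
  have hX' : ∀ (q : MvPolynomial V ℤ) (c : V), c ∉ Y →
      coeff (sqfreeExp (insert c Y)) (q * X c) = coeff (sqfreeExp Y) q := by
    intro q c hc
    rw [sqfreeExp, Finset.sum_insert hc, add_comm, coeff_mul_X, sqfreeExp]
  refine map_eq_zero_of_mem_relIdeal
    (lcoeff ℤ (sqfreeExp (insert a Y)) + lcoeff ℤ (sqfreeExp (insert b Y)))
    (fun q v => ?_) (fun q c d hcd => ?_) hp
  · rw [LinearMap.add_apply, lcoeff_apply, lcoeff_apply, coeff_sqfreeExp_mul_X_sq,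
      coeff_sqfreeExp_mul_X_sq, add_zero]
  · rw [LinearMap.add_apply, lcoeff_apply, lcoeff_apply, mul_sub, coeff_sub, coeff_sub]
    rcases Sym2.eq_iff.1 (Finset.mem_singleton.1 hcd) with ⟨rfl, rfl⟩ | ⟨rfl, rfl⟩
    · rw [hX' q c ha, hX' q d hb, hX q d c hb hab.symm, hX q c d ha hab]
      ring
    · rw [hX' q d ha, hX' q c hb, hX q c d hb hab.symm, hX q d c ha hab]
      ring

theorem mem_relIdeal_empty {p : MvPolynomial V ℤ}
    (h : ∀ Y : Finset V, coeff (sqfreeExp Y) p = 0) : p ∈ relIdeal (∅ : Finset (Sym2 V)) := by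
  rw [p.as_sum]
  refine Ideal.sum_mem _ fun m hm => ?_
  by_cases hm1 : ∀ v, m v ≤ 1
  · refine absurd (h m.support) ?_
    have : sqfreeExp m.support = m := by
      ext v
      rw [sqfreeExp_apply]
      have := hm1 v
      split_ifs with hv <;> rw [Finsupp.mem_support_iff] at hv <;> omega
    rw [this]
    exact mem_support_iff.1 hm
  · push Not at hm1
    obtain ⟨v, hv⟩ := hm1
    have hle : Finsupp.single v 2 ≤ m := Finsupp.single_le_iff.2 hv
    have : (monomial m (coeff m p) : MvPolynomial V ℤ) =
        monomial (m - Finsupp.single v 2) (coeff m p) * X v ^ 2 := by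
      rw [X_pow_eq_monomial, monomial_mul, tsub_add_cancel_of_le hle, mul_one]
    rw [this]
    exact Ideal.mul_mem_left _ _ (X_sq_mem_relIdeal _ _)

variable [Fintype V]

/-- On at least three vertices, a polynomial in all the ideals of edges has at most one nonzero
squarefree coefficient. -/
theorem coeff_eq_zero_of_forall_mem (hV : 3 ≤ Fintype.card V) {p : MvPolynomial V ℤ}
    (hp : ∀ a b : V, a ≠ b → p ∈ relIdeal {s(a, b)}) {Y : Finset V} (hY : Y ≠ Finset.univ) :
    coeff (sqfreeExp Y) p = 0 := by
  obtain ⟨a, ha⟩ : ∃ a, a ∉ Y := by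
    by_contra h
    push Not at h
    exact hY (Finset.eq_univ_iff_forall.2 h)
  by_cases hb : ∃ b, b ≠ a ∧ b ∉ Y
  · obtain ⟨b, hba, hb⟩ := hb
    exact coeff_eq_zero_of_mem_relIdeal hb ha (hp b a hba)
  · push Not at hb
    have hYa : Y = Finset.univ.erase a := by
      ext v
      rw [Finset.mem_erase]
      exact ⟨fun h => ⟨fun h' => ha (h' ▸ h), Finset.mem_univ v⟩, fun h => hb v h.1⟩
    -- The coefficients missing one vertex sum to zero in pairs; applied to three vertices, this
    -- makes twice each coefficient vanish.
    have hsum : ∀ c d : V, c ≠ d → coeff (sqfreeExp (Finset.univ.erase c)) p +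
        coeff (sqfreeExp (Finset.univ.erase d)) p = 0 := by
      intro c d hcd
      have h := coeff_insert_add_eq_zero (Y := (Finset.univ.erase d).erase c) hcd (by simp)
        (by simp) (hp c d hcd)
      rw [Finset.insert_erase (by simp [hcd]), Finset.erase_right_comm,
        Finset.insert_erase (by simp [hcd.symm])] at h
      rwa [add_comm]
    obtain ⟨b, hb'⟩ := Finset.exists_mem_notMem_of_card_lt_card (s := {a}) (t := Finset.univ)
      (by rw [Finset.card_singleton, Finset.card_univ]; omega)
    obtain ⟨c, hc'⟩ := Finset.exists_mem_notMem_of_card_lt_card (s := {a, b}) (t := Finset.univ)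
      (by
        have := Finset.card_le_two (a := a) (b := b)
        rw [Finset.card_univ]
        omega)
    have hba : b ≠ a := by simpa using hb'.2
    have hca : c ≠ a ∧ c ≠ b := by simpa using hc'.2
    have h1 := hsum a b hba.symm
    have h2 := hsum a c hca.1.symm
    have h3 := hsum b c hca.2.symm
    rw [hYa]
    omega

end DegreeZero

/-! ### Homology of complete graphs in degree zero -/

section DegreeZeroHomology

variable {n : ℕ} {j : ℤ}

/-- The product contains `X a * X b = X a ^ 2 - X a * (X a - X b)`. -/
theorem prod_X_mem_relIdeal {a b : Fin n} (hab : a ≠ b) {s : Finset (Sym2 (Fin n))}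
    (h : s(a, b) ∈ s) : (∏ v, X v : MvPolynomial (Fin n) ℤ) ∈ relIdeal s := by
  rw [← Finset.mul_prod_erase _ _ (Finset.mem_univ a),
    ← Finset.mul_prod_erase (Finset.univ.erase a) _
      (Finset.mem_erase.2 ⟨hab.symm, Finset.mem_univ b⟩), ← mul_assoc]
  refine Ideal.mul_mem_right _ _ ?_
  convert Ideal.sub_mem _ (X_sq_mem_relIdeal s a)
    (Ideal.mul_mem_left _ (X a) (X_sub_X_mem_relIdeal h)) using 1
  ring

theorem mem_relIdeal_of_mem_modelCycles {f : PreChain (Fin n)} (hf : f ∈ modelCycles (K n) 0 j)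
    {a b : Fin n} (hab : a ≠ b) : f ∅ ∈ relIdeal {s(a, b)} := by
  have h := hf.2 {s(a, b)} (subset_edgeSet_K.2 (by simpa using hab))
  rw [preDiff_apply, Finset.sum_singleton, Finset.erase_singleton] at h
  have h' := zsmul_mem_relIdeal (edgeSign ∅ s(a, b)) h
  rwa [smul_smul, edgeSign_mul_self, one_smul] at h'

theorem mem_modelBoundaries_zero_iff {f : PreChain (Fin n)}
    (hf : f ∈ bidegreePart (Fin n) 0 j) :
    f ∈ modelBoundaries (K n) 0 j ↔ f ∅ ∈ relIdeal ∅ := by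
  rw [mem_modelBoundaries]
  constructor
  · rintro ⟨y, hy, h⟩
    rw [eq_zero_of_mem_bidegreePart_of_neg hy (by norm_num), map_zero, sub_zero] at h
    exact h ∅ (by simp)
  · intro h
    refine ⟨0, Submodule.zero_mem _, fun s _ => ?_⟩
    rw [map_zero, sub_zero]
    by_cases h0 : f s = 0
    · rw [h0]
      exact Ideal.zero_mem _
    · have hs : s = ∅ := Finset.card_eq_zero.1 (by exact_mod_cast (hf s).1 h0)
      rwa [hs]

theorem single_prod_X_mem_modelCycles (c : ℤ) :
    (Pi.single ∅ (c • ∏ v, X v) : PreChain (Fin n)) ∈ modelCycles (K n) 0 n := by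
  refine ⟨fun s => ?_, fun s hs => ?_⟩
  · by_cases h : s = ∅
    · subst h
      refine ⟨fun _ => rfl, ?_⟩
      rw [Pi.single_eq_same]
      refine Submodule.smul_mem _ _ fun m hm => ?_
      rw [← monomial_sqfreeExp, coeff_monomial] at hm
      have hm' : sqfreeExp Finset.univ = m := by
        by_contra h'
        exact hm (if_neg h')
      rw [← hm', degree_sqfreeExp, Finset.card_univ, Fintype.card_fin]
    · rw [Pi.single_eq_of_ne h]
      exact ⟨fun h => absurd rfl h, Submodule.zero_mem _⟩
  · rw [preDiff_apply]
    refine Ideal.sum_mem _ fun e he => zsmul_mem_relIdeal _ ?_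
    by_cases h : s.erase e = ∅
    · rw [h, Pi.single_eq_same]
      refine zsmul_mem_relIdeal _ ?_
      have hdiag := subset_edgeSet_K.1 hs e he
      induction e with | h a b =>
      exact prod_X_mem_relIdeal (by simpa using hdiag) he
    · rw [Pi.single_eq_of_ne h]
      exact Ideal.zero_mem _

/-- The homology of a complete graph in degree zero. -/
theorem nonempty_modelHomology_zero_equiv (hn : 3 ≤ n) (j : ℤ) :
    Nonempty (ModelHomology (K n) 0 j ≃ₗ[ℤ]
      ((if j - n = 0 then ⊤ else ⊥ : Submodule ℤ ℤ) : Submodule ℤ ℤ)) := by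
  let L : modelCycles (K n) 0 j →ₗ[ℤ] ℤ :=
    lcoeff ℤ (sqfreeExp Finset.univ) ∘ₗ LinearMap.proj ∅ ∘ₗ (modelCycles (K n) 0 j).subtype
  have hL : ∀ f : modelCycles (K n) 0 j, L f = coeff (sqfreeExp Finset.univ) (f.1 ∅) :=
    fun _ => rfl
  have hmem : ∀ f, L f ∈ (if j - n = 0 then ⊤ else ⊥ : Submodule ℤ ℤ) := by
    intro f
    split_ifs with h
    · trivial
    · rw [Submodule.mem_bot, hL]
      by_contra hne
      have := (f.2.1 ∅).2 _ hne
      rw [degree_sqfreeExp, Finset.card_univ, Fintype.card_fin] at this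
      omega
  refine ⟨subquotientEquiv _ _ (L.codRestrict _ hmem) ?_ ?_⟩
  · rintro ⟨c, hc⟩
    by_cases h : j - n = 0
    · obtain rfl : j = n := by omega
      refine ⟨⟨_, single_prod_X_mem_modelCycles c⟩, Subtype.ext ?_⟩
      show coeff (sqfreeExp Finset.univ) ((Pi.single ∅ (c • ∏ v, X v) : PreChain (Fin n)) ∅) = c
      rw [Pi.single_eq_same, ← monomial_sqfreeExp, coeff_smul, coeff_monomial, if_pos rfl,
        smul_eq_mul, mul_one]
    · rw [if_neg h, Submodule.mem_bot] at hc
      exact ⟨0, Subtype.ext (by rw [map_zero]; exact hc.symm)⟩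
  · intro f
    rw [mem_modelBoundaries_zero_iff f.2.1, Subtype.ext_iff]
    show L f = 0 ↔ _
    rw [hL]
    constructor
    · intro h
      refine mem_relIdeal_empty fun Y => ?_
      by_cases hY : Y = Finset.univ
      · rw [hY, h]
      · exact coeff_eq_zero_of_forall_mem (by simpa using hn)
          (fun a b hab => mem_relIdeal_of_mem_modelCycles f.2 hab) hY
    · intro h
      exact map_eq_zero_of_mem_relIdeal (lcoeff ℤ (sqfreeExp Finset.univ))
        (fun q v => coeff_sqfreeExp_mul_X_sq _ q v) (fun q a b hab => by simp at hab) h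

end DegreeZeroHomology

end ChromaticHomology

end

/-! ### Transfer of the three cases from the polynomial model to chromatic homology -/

open ChromaticHomology in
theorem mainTheorem2 (n : ℕ) (hn : 4 ≤ n) :
    (H (K n) 0).Isomorphic (GrMod.int.shift n) ∧
    (∀ i : ℕ, 1 ≤ i → i ≤ n - 2 →
      (H (K n) i).Isomorphic
        (((H (K (n - 1)) (i - 1)).power (n - 2)).sum ((H (K (n - 1)) i).shift 1))) ∧
    (∀ i : ℕ, n - 1 ≤ i → (H (K n) i).Isomorphic GrMod.zero) := by
  obtain ⟨r, rfl⟩ : ∃ r, n = r + 1 + 1 := ⟨n - 2, by omega⟩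
  refine ⟨⟨fun j => ?_⟩, fun i hi _ => ?_, fun i hi => ⟨fun j => ?_⟩⟩
  · exact (homologyEquivModel _ 0 j).trans
      (nonempty_modelHomology_zero_equiv (n := r + 1 + 1) (by omega) j).some
  · obtain ⟨i, rfl⟩ : ∃ i', i = i' + 1 := ⟨i - 1, by omega⟩
    refine ⟨fun j => ?_⟩
    have h := nonempty_modelHomology_equiv (r := r) (by omega) ((i + 1 : ℕ) : ℤ) j
    rw [show ((i + 1 : ℕ) : ℤ) - 1 = (i : ℤ) by simp] at h
    exact (homologyEquivModel _ (i + 1) j).trans (h.some.trans (LinearEquiv.prodCongr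
      (LinearEquiv.piCongrRight fun _ => (homologyEquivModel (K (r + 1)) i j).symm)
      (homologyEquivModel (K (r + 1)) (i + 1) (j - 1)).symm))
  · refine (homologyEquivModel _ i j).trans (subquotientEquiv _ _ 0 (fun x => ⟨0, rfl⟩) fun z => ?_)
    have hz := modelCycles_le_modelBoundaries r (i := i) (j := j) (by omega) z.2
    exact ⟨fun _ => hz, fun _ => rfl⟩
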